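/- Let $R$ be a commutative unital ring, $S$ an inverse semigroup (write $s^*$ for the inverse of $s$, $s\le t$ iff $s=ts^*s$, and $E(S)$ for the set of idempotents), and $X$ a locally compact Hausdorff space with a basis of clopen sets. Let $\theta=(\{X_s\}_{s\in S},\{\theta_s\}_{s\in S})$ be a topological partial action of $S$ on $X$: each $X_s\subseteq X$ is open, each $\theta_s\colon X_{s^*}\to X_s$ is a homeomorphism, $\theta_{s^*}=\theta_s^{-1}$, $\theta_{st}$ extends $\theta_s\circ\theta_t$ (defined where it makes sense), $\theta_t$ extends $\theta_s$ whenever $s\le t$, and $X=\bigcup_{e\in E(S)}X_e$. Let $S\ltimes_\theta X$ be the groupoid of germs: its elements are the classes $[s,x]$ of pairs $(s,x)$ with $x\in X_{s^*}$, where $[s,x]=[t,y]$ iff $x=y$ and there is $u\le s,t$ with $x\in X_{u^*}$; the product is $[s,\theta_t(y)][t,y]=[st,y]$, the inverse is $[s,x]^{-1}=[s^*,\theta_s(x)]$, and the sets $[s,U]=\{[s,x]:x\in U\}$, with $U\subseteq X_{s^*}$ open, form a basis of its topology. It is an ample (not necessarily Hausdorff) groupoid. For an ample groupoid $G$ let $A_R(G)$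 be its Steinberg algebra, i.e. the $R$-submodule of $R^{G}$ spanned by the characteristic functions of compact-open bisections, with the convolution product $(f*g)(a)=\sum_{xy=a}f(x)g(y)$, and let $D_R(G)=\{f\in A_R(G): f=0 \text{ outside of } G^{(0)}\}$ be its diagonal subalgebra. Let $A_R(X)$ be the $R$-algebra of locally constant compactly supported functions $X\to R$ with pointwise operations, and let $\alpha$ be the dual partial action of $S$ on $A_R(X)$: $D_s=\{f\in A_R(X):f=0 \text{ outside of } X_s\}$ and $\alpha_s\colon D_{s^*}\to D_s$, $\alpha_s(f)=f\circ\theta_{s^*}$ on $X_s$ and $0$ outside of $X_s$. Let $\mathscr L$ be the $R$-module of finite formal sums $\sum_{s}a_s\delta_s$, $a_s\in D_s$, with the bilinear product given by $(a\delta_s)(b\delta_t)=\alpha_s(\alpha_{s^*}(a)b)\delta_{st}$, let $\mathscr N$ be the additive subgroup (an ideal) generated by the elements $a\delta_r-a\delta_s$ with $r\le s$ and $a\in D_r$, and let $A_R(X)\rtimes_\alpha S=\mathscr L/\mathscr N$ be the crossed product. Its diagonal is the additive subgroup generated by the classes of the elements $a\delta_e$ with $e\in E(S)$ and $a\in D_e$.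 Then there is an isomorphism of $R$-algebras $A_R(S\ltimes_\theta X)\cong A_R(X)\rtimes_\alpha S$ that maps the diagonal subalgebra $D_R(S\ltimes_\theta X)$ onto the diagonal of $A_R(X)\rtimes_\alpha S$. -/

import Mathlib

/-- An inverse semigroup: every `s` has exactly one `s⁻¹` with `s * s⁻¹ * s = s` and
`s⁻¹ * s * s⁻¹ = s⁻¹`. -/
class InverseSemigroup (S : Type*) extends Semigroup S, Inv S where
  mul_inv_mul : ∀ s : S, s * s⁻¹ * s = s
  inv_mul_inv : ∀ s : S, s⁻¹ * s * s⁻¹ = s⁻¹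
  inv_unique : ∀ s t : S, s * t * s = s → t * s * t = t → t = s⁻¹

namespace InverseSemigroup

variable {S : Type*} [InverseSemigroup S]

/-- The natural partial order of an inverse semigroup. -/
def NatLE (s t : S) : Prop := s = t * s⁻¹ * s

theorem inv_inv' (s : S) : s⁻¹⁻¹ = s :=
  (inv_unique s⁻¹ s (inv_mul_inv s) (mul_inv_mul s)).symm

theorem inv_of_idem {e : S} (he : e * e = e) : e⁻¹ = e :=
  (inv_unique e e (by rw [he, he]) (by rw [he, he])).symm

theorem idem_inv_mul (s : S) : s⁻¹ * s * (s⁻¹ * s) = s⁻¹ * s := by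
  rw [← mul_assoc, inv_mul_inv]

theorem idem_mul_inv (s : S) : s * s⁻¹ * (s * s⁻¹) = s * s⁻¹ := by
  rw [← mul_assoc, mul_inv_mul]

theorem idem_mul_idem {e f : S} (he : e * e = e) (hf : f * f = f) : e * f * (e * f) = e * f := by
  set x := (e * f)⁻¹ with hx
  have h1 : e * f * x * (e * f) = e * f := mul_inv_mul _
  have h2 : x * (e * f) * x = x := inv_mul_inv _
  have h3 : f * x * e = x := by
    apply inv_unique
    · calc e * f * (f * x * e) * (e * f) = e * (f * f) * x * (e * e) * f := by simp only [mul_assoc]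
        _ = e * f * x * (e * f) := by rw [he, hf]; simp only [mul_assoc]
        _ = _ := h1
    · calc f * x * e * (e * f) * (f * x * e) = f * (x * ((e * e) * (f * f)) * x) * e := by
            simp only [mul_assoc]
        _ = f * x * e := by rw [he, hf, h2]
  have h4 : x * x = x := by
    calc x * x = f * x * e * (f * x * e) := by rw [h3]
      _ = f * (x * (e * f) * x) * e := by simp only [mul_assoc]
      _ = x := by rw [h2, h3]
  have h5 : x = e * f := by
    rw [← inv_of_idem h4, hx, inv_inv']
  rw [← h5, h4]

theorem idem_comm {e f : S} (he : e * e = e) (hf : f * f = f) : e * f = f * e := by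
  have h1 := idem_mul_idem he hf
  have h2 := idem_mul_idem hf he
  have h3 : f * e = (e * f)⁻¹ := by
    apply inv_unique
    · calc e * f * (f * e) * (e * f) = e * (f * f) * (e * e) * f := by simp only [mul_assoc]
        _ = e * f := by rw [he, hf, mul_assoc (e * f), h1]
    · calc f * e * (e * f) * (f * e) = f * (e * e) * (f * f) * e := by simp only [mul_assoc]
        _ = f * e := by rw [he, hf, mul_assoc (f * e), h2]
  rw [h3, inv_of_idem h1]

theorem mul_inv' (s t : S) : (s * t)⁻¹ = t⁻¹ * s⁻¹ := by
  have hc := idem_comm (idem_inv_mul s) (idem_mul_inv t)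
  symm
  apply inv_unique
  · calc s * t * (t⁻¹ * s⁻¹) * (s * t) = s * ((t * t⁻¹) * (s⁻¹ * s)) * t := by
          simp only [mul_assoc]
      _ = (s * s⁻¹ * s) * (t * t⁻¹ * t) := by rw [← hc]; simp only [mul_assoc]
      _ = s * t := by rw [mul_inv_mul, mul_inv_mul]
  · calc t⁻¹ * s⁻¹ * (s * t) * (t⁻¹ * s⁻¹) = t⁻¹ * ((s⁻¹ * s) * (t * t⁻¹)) * s⁻¹ := by
          simp only [mul_assoc]
      _ = (t⁻¹ * t * t⁻¹) * (s⁻¹ * s * s⁻¹) := by rw [hc]; simp only [mul_assoc]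
      _ = t⁻¹ * s⁻¹ := by rw [inv_mul_inv, inv_mul_inv]

theorem natLE_mul_idem (t : S) {e : S} (he : e * e = e) : NatLE (t * e) t := by
  unfold NatLE
  have hc := idem_comm he (idem_inv_mul t)
  rw [mul_inv', inv_of_idem he]
  symm
  calc t * (e * t⁻¹) * (t * e) = t * (e * (t⁻¹ * t)) * e := by simp only [mul_assoc]
    _ = (t * t⁻¹ * t) * (e * e) := by rw [hc]; simp only [mul_assoc]
    _ = t * e := by rw [mul_inv_mul, he]

theorem natLE_iff {s t : S} : NatLE s t ↔ ∃ e : S, e * e = e ∧ s = t * e := by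
  constructor
  · intro h
    exact ⟨s⁻¹ * s, idem_inv_mul s, by rw [← mul_assoc]; exact h⟩
  · rintro ⟨e, he, rfl⟩
    exact natLE_mul_idem t he

theorem natLE_idem_mul (t : S) {e : S} (he : e * e = e) : NatLE (e * t) t := by
  refine natLE_iff.2 ⟨t⁻¹ * e * t, ?_, ?_⟩
  · have hc := idem_comm he (idem_mul_inv t)
    calc t⁻¹ * e * t * (t⁻¹ * e * t) = t⁻¹ * (e * (t * t⁻¹)) * e * t := by simp only [mul_assoc]
      _ = (t⁻¹ * t * t⁻¹) * (e * e) * t := by rw [hc]; simp only [mul_assoc]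
      _ = t⁻¹ * e * t := by rw [inv_mul_inv, he]
  · have hc := idem_comm he (idem_mul_inv t)
    calc e * t = e * (t * t⁻¹ * t) := by rw [mul_inv_mul]
      _ = (e * (t * t⁻¹)) * t := by simp only [mul_assoc]
      _ = t * (t⁻¹ * e * t) := by rw [hc]; simp only [mul_assoc]

theorem natLE_refl (s : S) : NatLE s s := (mul_inv_mul s).symm

theorem natLE_trans {s t u : S} (h : NatLE s t) (h' : NatLE t u) : NatLE s u := by
  obtain ⟨e, he, rfl⟩ := natLE_iff.1 h
  obtain ⟨f, hf, rfl⟩ := natLE_iff.1 h'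
  exact natLE_iff.2 ⟨f * e, idem_mul_idem hf he, mul_assoc _ _ _⟩

theorem natLE_mul {s t s' t' : S} (h : NatLE s s') (h' : NatLE t t') :
    NatLE (s * t) (s' * t') := by
  obtain ⟨e, he, rfl⟩ := natLE_iff.1 h
  obtain ⟨f, hf, rfl⟩ := natLE_iff.1 h'
  obtain ⟨g, hg, hg'⟩ := natLE_iff.1 (natLE_idem_mul t' he)
  refine natLE_iff.2 ⟨g * f, idem_mul_idem hg hf, ?_⟩
  calc s' * e * (t' * f) = s' * (e * t') * f := by simp only [mul_assoc]
    _ = s' * t' * (g * f) := by rw [hg']; simp only [mul_assoc]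

theorem natLE_inv {s t : S} (h : NatLE s t) : NatLE s⁻¹ t⁻¹ := by
  obtain ⟨e, he, rfl⟩ := natLE_iff.1 h
  rw [mul_inv', inv_of_idem he]
  exact natLE_idem_mul _ he

end InverseSemigroup

/-- An algebraic partial action of an inverse semigroup `S` on an associative (not necessarily
unital) `R`-algebra `A`: two-sided ideals `A_s = ideal s` and `R`-algebra isomorphisms
`α_s = act s : A_{s⁻¹} → A_s` such that `s ↦ α_s` is a partial homomorphism from `S` to the inverse
semigroup of partial bijections of `A` (where `f ≤ g` means that `g` extends `f`). -/
structure AlgPartialAction (R S A : Type*) [CommRing R] [InverseSemigroup S]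
    [NonUnitalRing A] [Module R A] [IsScalarTower R A A] [SMulCommClass R A A] where
  ideal : S → Submodule R A
  mul_mem_left : ∀ (s : S) (a b : A), b ∈ ideal s → a * b ∈ ideal s
  mul_mem_right : ∀ (s : S) (a b : A), a ∈ ideal s → a * b ∈ ideal s
  act : ∀ s : S, ideal s⁻¹ ≃ₗ[R] ideal s
  act_mul : ∀ (s : S) (a b c : ideal s⁻¹), (c : A) = a * b → (act s c : A) = act s a * act s b
  act_inv : ∀ (s : S) (a : ideal s⁻¹) (b : ideal s⁻¹⁻¹), (b : A) = act s a →
    (act s⁻¹ b : A) = a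
  act_comp : ∀ (s t : S) (a : ideal t⁻¹) (b : ideal s⁻¹), (b : A) = act t a →
    ∃ c : ideal (s * t)⁻¹, (c : A) = a ∧ (act (s * t) c : A) = act s b
  act_mono : ∀ s t : S, InverseSemigroup.NatLE s t → ∀ a : ideal s⁻¹,
    ∃ b : ideal t⁻¹, (b : A) = a ∧ (act t b : A) = act s a
  span_eq_top : Submodule.span R (⋃ e ∈ {e : S | e * e = e}, (ideal e : Set A)) = ⊤

namespace AlgPartialAction

open InverseSemigroup

variable {R S A : Type*} [CommRing R] [InverseSemigroup S]
  [NonUnitalRing A] [Module R A] [IsScalarTower R A A] [SMulCommClass R A A]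
  (α : AlgPartialAction R S A)

theorem ideal_mono {s t : S} (h : NatLE s t) {a : A} (ha : a ∈ α.ideal s) : a ∈ α.ideal t := by
  have h' := natLE_inv h
  have ha' : a ∈ α.ideal s⁻¹⁻¹ := by rwa [inv_inv']
  obtain ⟨b, hb, -⟩ := α.act_mono _ _ h' ⟨a, ha'⟩
  have := b.2
  rw [hb, inv_inv'] at this
  exact this

theorem act_symm_eq (s : S) (a : α.ideal s) (b : α.ideal s⁻¹⁻¹) (h : (b : A) = a) :
    (α.act s⁻¹ b : A) = (α.act s).symm a :=
  α.act_inv s ((α.act s).symm a) b (by rw [h, LinearEquiv.apply_symm_apply])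

/-- The element `α_s (α_{s⁻¹} a * b)`, for `a ∈ A_s` and `b ∈ A_t`, where `α_{s⁻¹}` is written as
the inverse map of `α_s`. -/
def twist (s : S) (a : α.ideal s) (b : A) : A :=
  α.act s ⟨((α.act s).symm a : A) * b, α.mul_mem_right _ _ _ ((α.act s).symm a).2⟩

theorem twist_mem (s t : S) (a : α.ideal s) (b : α.ideal t) :
    α.twist s a b ∈ α.ideal (s * t) := by
  set c : A := ((α.act s).symm a : A) * b with hc
  have h1 : c ∈ α.ideal s⁻¹ := α.mul_mem_right _ _ _ ((α.act s).symm a).2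
  have h2 : c ∈ α.ideal t := α.mul_mem_left _ _ _ b.2
  obtain ⟨d, -, hd⟩ := α.act_comp s t ((α.act t).symm ⟨c, h2⟩) ⟨c, h1⟩
    (by rw [LinearEquiv.apply_symm_apply])
  have : α.twist s a b = α.act (s * t) d := hd.symm
  rw [this]
  exact (α.act (s * t) d).2

theorem twist_add_left (s : S) (a a' : α.ideal s) (b : A) :
    α.twist s (a + a') b = α.twist s a b + α.twist s a' b := by
  unfold twist
  rw [← Submodule.coe_add, ← map_add]
  congr 2
  ext
  simp [add_mul]

theorem twist_smul_left (s : S) (r : R) (a : α.ideal s) (b : A) :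
    α.twist s (r • a) b = r • α.twist s a b := by
  unfold twist
  rw [← Submodule.coe_smul, ← map_smul]
  congr 2
  ext
  simp [smul_mul_assoc]

theorem twist_add_right (s : S) (a : α.ideal s) (b b' : A) :
    α.twist s a (b + b') = α.twist s a b + α.twist s a b' := by
  unfold twist
  rw [← Submodule.coe_add, ← map_add]
  congr 2
  ext
  simp [mul_add]

theorem twist_smul_right (s : S) (r : R) (a : α.ideal s) (b : A) :
    α.twist s a (r • b) = r • α.twist s a b := by
  unfold twist
  rw [← Submodule.coe_smul, ← map_smul]
  congr 2
  ext
  simp [mul_smul_comm]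

theorem twist_mono {s t : S} (h : NatLE s t) (a : A) (hs : a ∈ α.ideal s) (ht : a ∈ α.ideal t)
    (b : A) : α.twist s ⟨a, hs⟩ b = α.twist t ⟨a, ht⟩ b := by
  have key : (((α.act s).symm ⟨a, hs⟩ : α.ideal s⁻¹) : A) = (α.act t).symm ⟨a, ht⟩ := by
    obtain ⟨c, hc, hc'⟩ := α.act_mono _ _ h ((α.act s).symm ⟨a, hs⟩)
    rw [← hc]
    congr 1
    rw [LinearEquiv.eq_symm_apply]
    ext
    rw [hc', LinearEquiv.apply_symm_apply]
  unfold twist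
  obtain ⟨c, hc, hc'⟩ := α.act_mono _ _ h
    ⟨((α.act s).symm ⟨a, hs⟩ : A) * b, α.mul_mem_right _ _ _ ((α.act s).symm ⟨a, hs⟩).2⟩
  rw [← hc']
  congr 2
  ext
  rw [hc]
  simp only [key]

/-- The `R`-module `ℒ(α)` of finite formal sums `∑ a_s δ_s` with `a_s ∈ A_s`. -/
def PreCrossed : Type _ := DirectSum S fun s => α.ideal s

noncomputable instance : AddCommGroup α.PreCrossed :=
  inferInstanceAs (AddCommGroup (DirectSum S fun s => α.ideal s))

noncomputable instance : Module R α.PreCrossed :=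
  inferInstanceAs (Module R (DirectSum S fun s => α.ideal s))

open scoped Classical in
/-- The element `a δ_s` of `ℒ(α)`. -/
noncomputable def delta (s : S) : α.ideal s →ₗ[R] α.PreCrossed :=
  DirectSum.lof R S (fun s => α.ideal s) s

open scoped Classical in
/-- The `R`-linear map on `ℒ(α)` with prescribed values on the elements `a δ_s`. -/
noncomputable def liftPre {M : Type*} [AddCommGroup M] [Module R M]
    (φ : ∀ s : S, α.ideal s →ₗ[R] M) : α.PreCrossed →ₗ[R] M :=
  DirectSum.toModule R S M φ

theorem liftPre_delta {M : Type*} [AddCommGroup M] [Module R M]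
    (φ : ∀ s : S, α.ideal s →ₗ[R] M) (s : S) (a : α.ideal s) :
    α.liftPre φ (α.delta s a) = φ s a := by
  classical
  exact DirectSum.toModule_lof (M := fun s => α.ideal s) (φ := φ) R s a

theorem pre_induction {p : α.PreCrossed → Prop} (x : α.PreCrossed) (h0 : p 0)
    (hδ : ∀ s a, p (α.delta s a)) (hadd : ∀ x y, p x → p y → p (x + y)) : p x := by
  classical
  refine DirectSum.induction_on x h0 (fun s a => ?_) hadd
  exact hδ s a

/-- `(a δ_s) (b δ_t) = α_s (α_{s⁻¹} a * b) δ_{st}`. -/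
noncomputable def mulDelta (s t : S) : α.ideal s →ₗ[R] α.ideal t →ₗ[R] α.PreCrossed :=
  LinearMap.mk₂ R (fun a b => α.delta (s * t) ⟨α.twist s a b, α.twist_mem s t a b⟩)
    (fun a a' b => by
      rw [← map_add]; congr 1; ext; exact α.twist_add_left s a a' b)
    (fun r a b => by
      rw [← map_smul]; congr 1; ext; exact α.twist_smul_left s r a b)
    (fun a b b' => by
      rw [← map_add]; congr 1; ext; exact α.twist_add_right s a b b')
    (fun r a b => by
      rw [← map_smul]; congr 1; ext; exact α.twist_smul_right s r a b)

/-- The bilinear extension of `mulDelta`. -/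
noncomputable def mulPre : α.PreCrossed →ₗ[R] α.PreCrossed →ₗ[R] α.PreCrossed :=
  α.liftPre fun s => (α.liftPre fun t => (α.mulDelta s t).flip).flip

noncomputable instance : Mul α.PreCrossed := ⟨fun x y => α.mulPre x y⟩

theorem mul_eq_mulPre (x y : α.PreCrossed) : x * y = α.mulPre x y := rfl

theorem delta_mul_delta (s t : S) (a : α.ideal s) (b : α.ideal t) :
    α.delta s a * α.delta t b = α.delta (s * t) ⟨α.twist s a b, α.twist_mem s t a b⟩ := by
  rw [mul_eq_mulPre, mulPre, liftPre_delta, LinearMap.flip_apply, liftPre_delta]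
  rfl

noncomputable instance : NonUnitalNonAssocRing α.PreCrossed where
  left_distrib x y z := by simp only [mul_eq_mulPre, map_add]
  right_distrib x y z := by simp only [mul_eq_mulPre, map_add, LinearMap.add_apply]
  zero_mul x := by simp only [mul_eq_mulPre, map_zero, LinearMap.zero_apply]
  mul_zero x := by simp only [mul_eq_mulPre, map_zero]

instance : IsScalarTower R α.PreCrossed α.PreCrossed :=
  ⟨fun r x y => by simp only [smul_eq_mul, mul_eq_mulPre, map_smul, LinearMap.smul_apply]⟩

instance : SMulCommClass R α.PreCrossed α.PreCrossed :=
  ⟨fun r x y => by simp only [smul_eq_mul, mul_eq_mulPre, map_smul]⟩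

/-- The elements `a δ_r - a δ_s` of `ℒ(α)` with `r ≤ s` and `a ∈ A_r` (which is contained
in `A_s`). -/
def nullGen : Set α.PreCrossed :=
  {x | ∃ (r s : S) (_ : NatLE r s) (a : A) (hr : a ∈ α.ideal r) (hs : a ∈ α.ideal s),
    x = α.delta r ⟨a, hr⟩ - α.delta s ⟨a, hs⟩}

/-- The additive subgroup `𝒩(α)` of `ℒ(α)` generated by `nullGen`; it is an `R`-submodule. -/
noncomputable def nullIdeal : Submodule R α.PreCrossed where
  __ := AddSubgroup.closure α.nullGen
  smul_mem' c x hx := by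
    change c • x ∈ AddSubgroup.closure α.nullGen
    change x ∈ AddSubgroup.closure α.nullGen at hx
    induction hx using AddSubgroup.closure_induction with
    | mem x hx =>
      obtain ⟨r, s, h, a, hr, hs, rfl⟩ := hx
      refine AddSubgroup.subset_closure
        ⟨r, s, h, c • a, Submodule.smul_mem _ _ hr, Submodule.smul_mem _ _ hs, ?_⟩
      rw [smul_sub, ← map_smul, ← map_smul]
      rfl
    | zero => rw [smul_zero]; exact zero_mem _
    | add x y _ _ hx hy => rw [smul_add]; exact add_mem hx hy
    | neg x _ hx => rw [smul_neg]; exact neg_mem hx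

theorem mem_nullIdeal {x : α.PreCrossed} :
    x ∈ α.nullIdeal ↔ x ∈ AddSubgroup.closure α.nullGen := Iff.rfl

theorem mul_mem_nullIdeal_left (x y : α.PreCrossed) (hx : x ∈ α.nullIdeal) :
    x * y ∈ α.nullIdeal := by
  rw [mem_nullIdeal] at hx
  induction hx using AddSubgroup.closure_induction with
  | mem x hx =>
    obtain ⟨r, s, h, a, hr, hs, rfl⟩ := hx
    induction y using α.pre_induction with
    | h0 => rw [mul_zero]; exact zero_mem _
    | hδ t b =>
      rw [sub_mul, delta_mul_delta, delta_mul_delta]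
      have hle : NatLE (r * t) (s * t) := natLE_mul h (natLE_refl t)
      refine AddSubgroup.subset_closure ⟨r * t, s * t, hle, α.twist r ⟨a, hr⟩ b,
        α.twist_mem _ _ _ _, ?_, ?_⟩
      · rw [α.twist_mono h a hr hs]; exact α.twist_mem _ _ _ _
      · congr 3
        exact (α.twist_mono h a hr hs b).symm
    | hadd y z hy hz => rw [mul_add]; exact add_mem hy hz
  | zero => rw [zero_mul]; exact zero_mem _
  | add x y _ _ hx hy => rw [add_mul]; exact add_mem hx hy
  | neg x _ hx => rw [neg_mul]; exact neg_mem hx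

theorem mul_mem_nullIdeal_right (x y : α.PreCrossed) (hy : y ∈ α.nullIdeal) :
    x * y ∈ α.nullIdeal := by
  rw [mem_nullIdeal] at hy
  induction hy using AddSubgroup.closure_induction with
  | mem y hy =>
    obtain ⟨r, s, h, a, hr, hs, rfl⟩ := hy
    induction x using α.pre_induction with
    | h0 => rw [zero_mul]; exact zero_mem _
    | hδ t b =>
      rw [mul_sub, delta_mul_delta, delta_mul_delta]
      have hle : NatLE (t * r) (t * s) := natLE_mul (natLE_refl t) h
      exact AddSubgroup.subset_closure ⟨t * r, t * s, hle, α.twist t b a,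
        α.twist_mem t r b ⟨a, hr⟩, α.twist_mem t s b ⟨a, hs⟩, rfl⟩
    | hadd y z hy hz => rw [add_mul]; exact add_mem hy hz
  | zero => rw [mul_zero]; exact zero_mem _
  | add x y _ _ hx hy => rw [mul_add]; exact add_mem hx hy
  | neg x _ hx => rw [mul_neg]; exact neg_mem hx

/-- The crossed product `A ⋊_α S = ℒ(α) / 𝒩(α)`. -/
def CrossedProduct : Type _ := α.PreCrossed ⧸ α.nullIdeal

noncomputable instance : AddCommGroup α.CrossedProduct :=
  inferInstanceAs (AddCommGroup (α.PreCrossed ⧸ α.nullIdeal))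

noncomputable instance : Module R α.CrossedProduct :=
  inferInstanceAs (Module R (α.PreCrossed ⧸ α.nullIdeal))

/-- The quotient map `x ↦ x̄` from `ℒ(α)` onto the crossed product. -/
noncomputable def toCrossed : α.PreCrossed →ₗ[R] α.CrossedProduct := α.nullIdeal.mkQ

theorem toCrossed_surjective : Function.Surjective α.toCrossed :=
  Submodule.mkQ_surjective _

theorem toCrossed_eq_zero {x : α.PreCrossed} : α.toCrossed x = 0 ↔ x ∈ α.nullIdeal :=
  Submodule.Quotient.mk_eq_zero _

/-- The linear map on the crossed product induced by a linear map on `ℒ(α)` that vanishes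
on `𝒩(α)`. -/
noncomputable def liftCrossed {M : Type*} [AddCommGroup M] [Module R M]
    (f : α.PreCrossed →ₗ[R] M) (h : ∀ x ∈ α.nullIdeal, f x = 0) : α.CrossedProduct →ₗ[R] M :=
  α.nullIdeal.liftQ f h

theorem liftCrossed_toCrossed {M : Type*} [AddCommGroup M] [Module R M]
    (f : α.PreCrossed →ₗ[R] M) (h : ∀ x ∈ α.nullIdeal, f x = 0) (x : α.PreCrossed) :
    α.liftCrossed f h (α.toCrossed x) = f x := rfl

/-- Left multiplication by an element of `ℒ(α)`, as a map on the crossed product. -/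
noncomputable def mulCrossedAux (x : α.PreCrossed) : α.CrossedProduct →ₗ[R] α.CrossedProduct :=
  α.liftCrossed (α.toCrossed ∘ₗ α.mulPre x)
    fun y hy => α.toCrossed_eq_zero.2 (α.mul_mem_nullIdeal_right x y hy)

theorem mulCrossedAux_toCrossed (x y : α.PreCrossed) :
    α.mulCrossedAux x (α.toCrossed y) = α.toCrossed (x * y) := rfl

/-- The product of the crossed product, induced by that of `ℒ(α)`. -/
noncomputable def mulCrossed :
    α.CrossedProduct →ₗ[R] α.CrossedProduct →ₗ[R] α.CrossedProduct :=
  α.liftCrossed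
    { toFun := α.mulCrossedAux
      map_add' := fun x x' => LinearMap.ext fun y => by
        obtain ⟨y, rfl⟩ := α.toCrossed_surjective y
        rw [LinearMap.add_apply]
        simp only [mulCrossedAux_toCrossed, add_mul, map_add]
      map_smul' := fun r x => LinearMap.ext fun y => by
        obtain ⟨y, rfl⟩ := α.toCrossed_surjective y
        rw [LinearMap.smul_apply]
        simp only [mulCrossedAux_toCrossed, smul_mul_assoc, map_smul, RingHom.id_apply] }
    fun x hx => LinearMap.ext fun y => by
      obtain ⟨y, rfl⟩ := α.toCrossed_surjective y
      exact α.toCrossed_eq_zero.2 (α.mul_mem_nullIdeal_left x y hx)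

noncomputable instance : Mul α.CrossedProduct := ⟨fun x y => α.mulCrossed x y⟩

theorem toCrossed_mul (x y : α.PreCrossed) :
    α.toCrossed (x * y) = α.toCrossed x * α.toCrossed y := rfl

theorem mul_eq_mulCrossed (x y : α.CrossedProduct) : x * y = α.mulCrossed x y := rfl

noncomputable instance : NonUnitalNonAssocRing α.CrossedProduct where
  left_distrib x y z := by simp only [mul_eq_mulCrossed, map_add]
  right_distrib x y z := by simp only [mul_eq_mulCrossed, map_add, LinearMap.add_apply]
  zero_mul x := by simp only [mul_eq_mulCrossed, map_zero, LinearMap.zero_apply]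
  mul_zero x := by simp only [mul_eq_mulCrossed, map_zero]

instance : IsScalarTower R α.CrossedProduct α.CrossedProduct :=
  ⟨fun r x y => by simp only [smul_eq_mul, mul_eq_mulCrossed, map_smul, LinearMap.smul_apply]⟩

instance : SMulCommClass R α.CrossedProduct α.CrossedProduct :=
  ⟨fun r x y => by simp only [smul_eq_mul, mul_eq_mulCrossed, map_smul]⟩

/-- The diagonal of the crossed product: the additive subgroup generated by the classes of the
elements `a δ_e` with `e` idempotent and `a ∈ A_e`. -/
noncomputable def diagonal : AddSubgroup α.CrossedProduct :=
  AddSubgroup.closure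
    {x | ∃ (e : S) (_ : e * e = e) (a : α.ideal e), x = α.toCrossed (α.delta e a)}

end AlgPartialAction

/-- A topological space is zero-dimensional if its clopen subsets form a basis. -/
class ZeroDimSpace (X : Type*) [TopologicalSpace X] : Prop where
  basis : TopologicalSpace.IsTopologicalBasis {U : Set X | IsClopen U}

/-- The algebra `A_R(X)` of locally constant compactly supported `R`-valued functions on a
Hausdorff space `X`, with pointwise operations. -/
def LocConstAlgebra (R X : Type*) [CommRing R] [TopologicalSpace X] [T2Space X] :
    NonUnitalSubalgebra R (X → R) where
  carrier := {f | IsLocallyConstant f ∧ IsCompact (Function.support f)}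
  zero_mem' := ⟨IsLocallyConstant.const 0, by
    rw [Function.support_zero]; exact isCompact_empty⟩
  add_mem' := by
    rintro f g ⟨hf, hf'⟩ ⟨hg, hg'⟩
    refine ⟨hf.add hg, (hf'.union hg').of_isClosed_subset ?_ (Function.support_add f g)⟩
    exact ((hf.add hg).isClopen_fiber 0).compl.isClosed
  mul_mem' := by
    rintro f g ⟨hf, hf'⟩ ⟨hg, -⟩
    refine ⟨hf.mul hg, hf'.of_isClosed_subset ?_ (Function.support_mul_subset_left f g)⟩
    exact ((hf.mul hg).isClopen_fiber 0).compl.isClosed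
  smul_mem' := by
    rintro r f ⟨hf, hf'⟩
    have h : IsLocallyConstant (r • f) := hf.comp (fun y => r • y)
    refine ⟨h, hf'.of_isClosed_subset (h.isClopen_fiber 0).compl.isClosed ?_⟩
    exact Function.support_const_smul_subset r f

/-- A topological partial action of an inverse semigroup `S` on a topological space `X`: open sets
`X_s = dom s` and homeomorphisms `θ_s = map s : X_{s⁻¹} → X_s` such that `s ↦ θ_s` is a partial
homomorphism from `S` to the inverse semigroup of partial bijections of `X` (where `f ≤ g` means
that `g` extends `f`), and such that the sets `X_e`, for `e` idempotent, cover `X`. The values of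
`map s` outside of its source `X_{s⁻¹}` play no role. -/
structure TopPartialAction (S X : Type*) [InverseSemigroup S] [TopologicalSpace X] where
  dom : S → Set X
  map : S → OpenPartialHomeomorph X X
  source_eq : ∀ s, (map s).source = dom s⁻¹
  target_eq : ∀ s, (map s).target = dom s
  map_inv : ∀ s, ∀ x ∈ dom s, map s⁻¹ x = (map s).symm x
  map_comp : ∀ s t, ∀ x ∈ dom t⁻¹, map t x ∈ dom s⁻¹ →
    x ∈ dom (s * t)⁻¹ ∧ map (s * t) x = map s (map t x)
  map_mono : ∀ s t, InverseSemigroup.NatLE s t → ∀ x ∈ dom s⁻¹, x ∈ dom t⁻¹ ∧ map t x = map s x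
  cover : ∀ x, ∃ e : S, e * e = e ∧ x ∈ dom e

namespace TopPartialAction

open InverseSemigroup

variable {S X : Type*} [InverseSemigroup S] [TopologicalSpace X] (θ : TopPartialAction S X)

theorem isOpen_dom (s : S) : IsOpen (θ.dom s) := by
  rw [← θ.target_eq]; exact (θ.map s).open_target

theorem map_mem {s : S} {x : X} (hx : x ∈ θ.dom s⁻¹) : θ.map s x ∈ θ.dom s := by
  rw [← θ.target_eq]
  exact (θ.map s).map_source (by rwa [θ.source_eq])

theorem map_inv_mem {s : S} {x : X} (hx : x ∈ θ.dom s) : θ.map s⁻¹ x ∈ θ.dom s⁻¹ :=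
  θ.map_mem (by rwa [inv_inv'])

theorem map_inv_map {s : S} {x : X} (hx : x ∈ θ.dom s⁻¹) : θ.map s⁻¹ (θ.map s x) = x := by
  rw [θ.map_inv _ _ (θ.map_mem hx)]
  exact (θ.map s).left_inv (by rwa [θ.source_eq])

theorem map_map_inv {s : S} {x : X} (hx : x ∈ θ.dom s) : θ.map s (θ.map s⁻¹ x) = x := by
  rw [θ.map_inv _ _ hx]
  exact (θ.map s).right_inv (by rwa [θ.target_eq])

theorem continuousOn_map (s : S) : ContinuousOn (θ.map s) (θ.dom s⁻¹) := by
  rw [← θ.source_eq]; exact (θ.map s).continuousOn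

theorem dom_mono {s t : S} (h : NatLE s t) {x : X} (hx : x ∈ θ.dom s) : x ∈ θ.dom t := by
  have := (θ.map_mono _ _ (natLE_inv h) x (by rwa [inv_inv'])).1
  rwa [inv_inv'] at this

theorem map_idem {e : S} (he : e * e = e) {x : X} (hx : x ∈ θ.dom e) : θ.map e x = x := by
  have hi := inv_of_idem he
  have hx' : x ∈ θ.dom e⁻¹ := by rwa [hi]
  have h1 : θ.map e (θ.map e x) = x := by
    have := θ.map_inv_map hx'
    rwa [hi] at this
  have h2 := (θ.map_comp e e x hx' (by rw [hi]; exact θ.map_mem hx')).2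
  rw [he, h1] at h2
  exact h2

variable {R : Type*} [CommRing R]

open scoped Classical in
/-- The function `f ∘ θ_{s⁻¹}` on `X_s`, extended by zero outside of `X_s`. -/
noncomputable def dualFun (s : S) (f : X → R) : X → R :=
  fun x => if x ∈ θ.dom s then f (θ.map s⁻¹ x) else 0

theorem dualFun_of_mem {s : S} (f : X → R) {x : X} (hx : x ∈ θ.dom s) :
    θ.dualFun s f x = f (θ.map s⁻¹ x) := by
  simp [dualFun, hx]

theorem dualFun_of_notMem {s : S} (f : X → R) {x : X} (hx : x ∉ θ.dom s) :
    θ.dualFun s f x = 0 := by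
  simp [dualFun, hx]

theorem support_dualFun_subset (s : S) (f : X → R) :
    Function.support (θ.dualFun s f) ⊆ θ.dom s := by
  intro x hx
  by_contra h
  exact hx (θ.dualFun_of_notMem f h)

variable (R) [T2Space X]

/-- The ideal `D_s` of the functions in `A_R(X)` with support contained in `X_s`. -/
def dualIdeal (s : S) : Submodule R (LocConstAlgebra R X) where
  carrier := {f | Function.support (f : X → R) ⊆ θ.dom s}
  zero_mem' := by simp
  add_mem' := fun {f g} hf hg => (Function.support_add _ _).trans (Set.union_subset hf hg)
  smul_mem' := fun r f hf => (Function.support_const_smul_subset r (f : X → R)).trans hf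

theorem mem_dualIdeal {s : S} {f : LocConstAlgebra R X} :
    f ∈ θ.dualIdeal R s ↔ Function.support (f : X → R) ⊆ θ.dom s := Iff.rfl

variable {R}

theorem apply_eq_zero {s : S} (f : θ.dualIdeal R s) {x : X} (hx : x ∉ θ.dom s) :
    (f : LocConstAlgebra R X).1 x = 0 := by
  by_contra h
  exact hx (f.2 h)

theorem dualFun_mem (s : S) (f : θ.dualIdeal R s⁻¹) :
    θ.dualFun s (f : LocConstAlgebra R X).1 ∈ LocConstAlgebra R X := by
  obtain ⟨⟨f, hf, hfc⟩, hfs⟩ := f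
  have hfs : Function.support f ⊆ θ.dom s⁻¹ := hfs
  change θ.dualFun s f ∈ LocConstAlgebra R X
  have hsupp : Function.support (θ.dualFun s f) = θ.map s '' Function.support f := by
    ext x
    constructor
    · intro hx
      have hxs := θ.support_dualFun_subset s f hx
      rw [Function.mem_support, θ.dualFun_of_mem f hxs] at hx
      exact ⟨_, hx, θ.map_map_inv hxs⟩
    · rintro ⟨y, hy, rfl⟩
      have hys := hfs hy
      rw [Function.mem_support, θ.dualFun_of_mem f (θ.map_mem hys), θ.map_inv_map hys]
      exact hy
  have hc : IsCompact (Function.support (θ.dualFun s f)) := by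
    rw [hsupp]
    exact hfc.image_of_continuousOn ((θ.continuousOn_map s).mono hfs)
  refine ⟨(IsLocallyConstant.iff_eventually_eq _).2 fun x => ?_, hc⟩
  by_cases hx : x ∈ θ.dom s
  · have hcont : ContinuousAt (θ.map s⁻¹) x := by
      refine (θ.continuousOn_map s⁻¹).continuousAt ?_
      rw [inv_inv']
      exact (θ.isOpen_dom s).mem_nhds hx
    have h1 := hcont.eventually ((IsLocallyConstant.iff_eventually_eq _).1 hf (θ.map s⁻¹ x))
    filter_upwards [h1, (θ.isOpen_dom s).mem_nhds hx] with y hy hys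
    rw [θ.dualFun_of_mem f hys, θ.dualFun_of_mem f hx, hy]
  · have hx0 : x ∉ Function.support (θ.dualFun s f) :=
      fun h => hx (θ.support_dualFun_subset s f h)
    filter_upwards [hc.isClosed.isOpen_compl.mem_nhds hx0] with y hy
    rw [Function.notMem_support.1 hy, θ.dualFun_of_notMem f hx]

/-- The map `α_s : D_{s⁻¹} → D_s`, `f ↦ f ∘ θ_{s⁻¹}`. -/
noncomputable def dualMap (s : S) : θ.dualIdeal R s⁻¹ →ₗ[R] θ.dualIdeal R s where
  toFun f := ⟨⟨θ.dualFun s (f : LocConstAlgebra R X).1, θ.dualFun_mem s f⟩,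
    θ.support_dualFun_subset s _⟩
  map_add' f g := by
    ext x
    by_cases hx : x ∈ θ.dom s
    · simp [dualFun, hx]
    · simp [dualFun, hx]
  map_smul' r f := by
    ext x
    by_cases hx : x ∈ θ.dom s
    · simp [dualFun, hx]
    · simp [dualFun, hx]

theorem dualMap_apply_of_mem {s : S} (f : θ.dualIdeal R s⁻¹) {x : X} (hx : x ∈ θ.dom s) :
    (θ.dualMap s f : LocConstAlgebra R X).1 x = (f : LocConstAlgebra R X).1 (θ.map s⁻¹ x) :=
  θ.dualFun_of_mem _ hx

theorem dualMap_apply_of_notMem {s : S} (f : θ.dualIdeal R s⁻¹) {x : X} (hx : x ∉ θ.dom s) :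
    (θ.dualMap s f : LocConstAlgebra R X).1 x = 0 :=
  θ.dualFun_of_notMem _ hx

theorem dualMap_inv (s : S) (a : θ.dualIdeal R s⁻¹) (b : θ.dualIdeal R s⁻¹⁻¹)
    (h : (b : LocConstAlgebra R X) = θ.dualMap s a) :
    (θ.dualMap s⁻¹ b : LocConstAlgebra R X) = a := by
  ext x
  by_cases hx : x ∈ θ.dom s⁻¹
  · rw [θ.dualMap_apply_of_mem b hx, h, inv_inv', θ.dualMap_apply_of_mem a (θ.map_mem hx),
      θ.map_inv_map hx]
  · rw [θ.dualMap_apply_of_notMem b hx, θ.apply_eq_zero a hx]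

theorem dualMap_bijective (s : S) :
    Function.Bijective (θ.dualMap s : θ.dualIdeal R s⁻¹ →ₗ[R] θ.dualIdeal R s) := by
  have hi : θ.dualIdeal R s⁻¹⁻¹ = θ.dualIdeal R s := by rw [inv_inv']
  constructor
  · intro a b hab
    ext1
    have hm : (θ.dualMap s a : LocConstAlgebra R X) ∈ θ.dualIdeal R s⁻¹⁻¹ := by
      rw [hi]; exact (θ.dualMap s a).2
    rw [← θ.dualMap_inv s a ⟨_, hm⟩ rfl, ← θ.dualMap_inv s b ⟨_, hm⟩ (congrArg Subtype.val hab)]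
  · intro b
    refine ⟨θ.dualMap s⁻¹ ⟨b, by rw [hi]; exact b.2⟩, ?_⟩
    ext x
    by_cases hx : x ∈ θ.dom s
    · rw [θ.dualMap_apply_of_mem _ hx, θ.dualMap_apply_of_mem _ (θ.map_inv_mem hx),
        θ.map_inv_map (s := s⁻¹) (by rwa [inv_inv'])]
    · rw [θ.dualMap_apply_of_notMem _ hx, θ.apply_eq_zero b hx]

theorem indicator_mem {W : Set X} (hW : IsClopen W) (f : LocConstAlgebra R X) :
    W.indicator f.1 ∈ LocConstAlgebra R X := by
  obtain ⟨f, hf, hfc⟩ := f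
  have h : IsLocallyConstant (W.indicator f) := by
    rw [IsLocallyConstant.iff_eventually_eq]
    intro x
    by_cases hx : x ∈ W
    · filter_upwards [(IsLocallyConstant.iff_eventually_eq _).1 hf x, hW.isOpen.mem_nhds hx]
        with y hy hyW
      rw [Set.indicator_of_mem hyW, Set.indicator_of_mem hx, hy]
    · filter_upwards [hW.isClosed.isOpen_compl.mem_nhds hx] with y hy
      rw [Set.indicator_of_notMem hy, Set.indicator_of_notMem hx]
  refine ⟨h, hfc.of_isClosed_subset (h.isClopen_fiber 0).compl.isClosed ?_⟩
  rw [Set.support_indicator]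
  exact Set.inter_subset_right

theorem dual_span [ZeroDimSpace X] :
    Submodule.span R
      (⋃ e ∈ {e : S | e * e = e}, (θ.dualIdeal R e : Set (LocConstAlgebra R X))) = ⊤ := by
  set M := Submodule.span R
      (⋃ e ∈ {e : S | e * e = e}, (θ.dualIdeal R e : Set (LocConstAlgebra R X))) with hM
  rw [eq_top_iff]
  rintro f -
  have key : ∃ W : Set X, IsClopen W ∧ Function.support f.1 ⊆ W ∧
      ∀ g : LocConstAlgebra R X, Function.support g.1 ⊆ W → g ∈ M := by
    refine f.2.2.induction_on (p := fun T => ∃ W : Set X, IsClopen W ∧ T ⊆ W ∧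
      ∀ g : LocConstAlgebra R X, Function.support g.1 ⊆ W → g ∈ M) ?_ ?_ ?_ ?_
    · refine ⟨∅, isClopen_empty, subset_rfl, fun g hg => ?_⟩
      have : g = 0 := by
        ext x
        exact Function.notMem_support.1 (fun h => hg h)
      rw [this]
      exact zero_mem _
    · rintro T T' hT ⟨W, h1, h2, h3⟩
      exact ⟨W, h1, hT.trans h2, h3⟩
    · rintro T T' ⟨W, h1, h2, h3⟩ ⟨W', h1', h2', h3'⟩
      refine ⟨W ∪ W', h1.union h1', Set.union_subset_union h2 h2', fun g hg => ?_⟩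
      have hg' : g = ⟨W.indicator g.1, indicator_mem h1 g⟩ +
          ⟨Wᶜ.indicator g.1, indicator_mem h1.compl g⟩ := by
        apply Subtype.ext
        change g.1 = W.indicator g.1 + Wᶜ.indicator g.1
        exact (Set.indicator_self_add_compl W g.1).symm
      rw [hg']
      refine add_mem (h3 _ ?_) (h3' _ ?_)
      · change Function.support (W.indicator g.1) ⊆ W
        rw [Set.support_indicator]
        exact Set.inter_subset_left
      · change Function.support (Wᶜ.indicator g.1) ⊆ W'
        rw [Set.support_indicator]
        rintro x ⟨hx, hx'⟩
        exact (hg hx').resolve_left hx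
    · intro x _
      obtain ⟨e, he, hxe⟩ := θ.cover x
      obtain ⟨W, hW, hxW, hWe⟩ :=
        ZeroDimSpace.basis.exists_subset_of_mem_open hxe (θ.isOpen_dom e)
      refine ⟨W, mem_nhdsWithin_of_mem_nhds (IsClopen.isOpen hW |>.mem_nhds hxW), W, hW, subset_rfl,
        fun g hg => Submodule.subset_span ?_⟩
      exact Set.mem_biUnion (show e ∈ {e : S | e * e = e} from he) (hg.trans hWe)
  obtain ⟨W, -, h, h'⟩ := key
  exact h' f h

variable (R)

/-- The dual partial action `α = ({D_s}, {α_s})` of `S` on `A_R(X)`. -/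
noncomputable def dual [ZeroDimSpace X] : AlgPartialAction R S (LocConstAlgebra R X) where
  ideal := θ.dualIdeal R
  mul_mem_left s f g hg := (Function.support_mul_subset_right _ _).trans hg
  mul_mem_right s f g hf := (Function.support_mul_subset_left _ _).trans hf
  act s := LinearEquiv.ofBijective (θ.dualMap s) (θ.dualMap_bijective s)
  act_mul s a b c h := by
    ext x
    simp only [LinearEquiv.ofBijective_apply]
    by_cases hx : x ∈ θ.dom s
    · rw [θ.dualMap_apply_of_mem _ hx, h]
      change _ = (θ.dualMap s a).1.1 x * (θ.dualMap s b).1.1 x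
      rw [θ.dualMap_apply_of_mem _ hx, θ.dualMap_apply_of_mem _ hx]
      rfl
    · rw [θ.dualMap_apply_of_notMem _ hx]
      change _ = (θ.dualMap s a).1.1 x * (θ.dualMap s b).1.1 x
      rw [θ.dualMap_apply_of_notMem _ hx, zero_mul]
  act_inv s a b h := θ.dualMap_inv s a b h
  act_comp s t a b h := by
    have hb : ∀ x, b.1.1 x = (θ.dualMap t a).1.1 x := fun x => by rw [h]; rfl
    have hsupp : ∀ x, a.1.1 x ≠ 0 → x ∈ θ.dom t⁻¹ ∧ θ.map t x ∈ θ.dom s⁻¹ := by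
      intro x hx
      have hxt := a.2 hx
      refine ⟨hxt, b.2 ?_⟩
      rw [Function.mem_support, hb, θ.dualMap_apply_of_mem _ (θ.map_mem hxt),
        θ.map_inv_map hxt]
      exact hx
    refine ⟨⟨a.1, fun x hx => ?_⟩, rfl, ?_⟩
    · exact (θ.map_comp s t x (hsupp x hx).1 (hsupp x hx).2).1
    · ext x
      simp only [LinearEquiv.ofBijective_apply]
      by_cases hxs : x ∈ θ.dom s ∧ θ.map s⁻¹ x ∈ θ.dom t
      · obtain ⟨h1, h2⟩ := hxs
        have hc := θ.map_comp t⁻¹ s⁻¹ x (by rwa [inv_inv']) (by rwa [inv_inv'])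
        rw [← mul_inv', inv_inv'] at hc
        rw [θ.dualMap_apply_of_mem _ hc.1, θ.dualMap_apply_of_mem _ h1, hb,
          θ.dualMap_apply_of_mem _ h2, hc.2]
      · have hz : (θ.dualMap s b).1.1 x = 0 := by
          by_cases h1 : x ∈ θ.dom s
          · rw [θ.dualMap_apply_of_mem _ h1, hb]
            exact θ.dualMap_apply_of_notMem _ (fun h2 => hxs ⟨h1, h2⟩)
          · exact θ.dualMap_apply_of_notMem _ h1
        rw [hz]
        by_cases h1 : x ∈ θ.dom (s * t)
        · rw [θ.dualMap_apply_of_mem _ h1]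
          by_contra hne
          obtain ⟨h2, h3⟩ := hsupp _ hne
          have hc := θ.map_comp s t _ h2 h3
          rw [θ.map_map_inv h1] at hc
          apply hxs
          rw [hc.2]
          exact ⟨θ.map_mem h3, by rw [θ.map_inv_map h3]; exact θ.map_mem h2⟩
        · exact θ.dualMap_apply_of_notMem _ h1
  act_mono s t h a := by
    refine ⟨⟨a.1, fun x hx => (θ.map_mono s t h x (a.2 hx)).1⟩, rfl, ?_⟩
    ext x
    simp only [LinearEquiv.ofBijective_apply]
    by_cases hx : x ∈ θ.dom s
    · rw [θ.dualMap_apply_of_mem _ (θ.dom_mono h hx), θ.dualMap_apply_of_mem _ hx,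
        (θ.map_mono _ _ (natLE_inv h) x (by rwa [inv_inv'])).2]
    · rw [θ.dualMap_apply_of_notMem _ hx]
      by_cases hxt : x ∈ θ.dom t
      · rw [θ.dualMap_apply_of_mem _ hxt]
        by_contra hne
        have h1 : θ.map t⁻¹ x ∈ θ.dom s⁻¹ := a.2 hne
        have h2 := (θ.map_mono s t h _ h1).2
        rw [θ.map_map_inv hxt] at h2
        exact hx (h2 ▸ θ.map_mem h1)
      · exact θ.dualMap_apply_of_notMem _ hxt
  span_eq_top := θ.dual_span

end TopPartialAction

/-- A groupoid, given by its set of arrows `G`; objects are identified with unit arrows.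
The product `mul a b h` is defined when `h : src a = rng b`. -/
class ArrowGroupoid (G : Type*) where
  src : G → G
  rng : G → G
  inv : G → G
  mul : ∀ a b : G, src a = rng b → G
  src_mul : ∀ a b h, src (mul a b h) = src b
  rng_mul : ∀ a b h, rng (mul a b h) = rng a
  src_inv : ∀ a, src (inv a) = rng a
  rng_inv : ∀ a, rng (inv a) = src a
  rng_src : ∀ a, rng (src a) = src a
  src_rng : ∀ a, src (rng a) = rng a
  mul_assoc : ∀ a b c (h : src a = rng b) (h' : src b = rng c),
    mul (mul a b h) c ((src_mul a b h).trans h') = mul a (mul b c h') (h.trans (rng_mul b c h').symm)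
  mul_src : ∀ a, mul a (src a) (rng_src a).symm = a
  rng_mul_self : ∀ a, mul (rng a) a (src_rng a) = a
  inv_mul : ∀ a, mul (inv a) a (src_inv a) = src a
  mul_inv : ∀ a, mul a (inv a) (rng_inv a).symm = rng a

namespace ArrowGroupoid

variable (G : Type*) [ArrowGroupoid G]

/-- The unit space `G⁽⁰⁾`. -/
def units : Set G := Set.range (src : G → G)

/-- The set `G⁽²⁾` of composable pairs. -/
abbrev Composable : Type _ := {p : G × G // src p.1 = rng p.2}

variable {G}

/-- The source map, with values in the unit space. -/
def srcUnit (a : G) : units G := ⟨src a, a, rfl⟩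

theorem srcUnit_eq_iff {a b : G} : srcUnit a = srcUnit b ↔ src a = src b := Subtype.ext_iff

theorem src_src (a : G) : src (src a) = src a := by
  have h := src_mul (inv a) a (src_inv a)
  rwa [inv_mul] at h

theorem src_of_mem_units {a : G} (h : a ∈ units G) : src a = a := by
  obtain ⟨b, rfl⟩ := h
  exact src_src b

theorem mul_congr {a a' b b' : G} (ha : a = a') (hb : b = b') (h : src a = rng b) :
    mul a b h = mul a' b' (ha ▸ hb ▸ h) := by
  subst ha hb; rfl

theorem mul_inv_cancel (a b : G) (h : src a = src b) :
    mul (mul a (inv b) (h.trans (rng_inv b).symm)) b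
      ((src_mul _ _ _).trans (src_inv b)) = a := by
  rw [mul_assoc a (inv b) b (h.trans (rng_inv b).symm) (src_inv b),
    mul_congr rfl (inv_mul b), mul_congr rfl h.symm, mul_src]

theorem mul_mul_inv (a b : G) (h : src a = rng b) :
    mul (mul a b h) (inv b) ((src_mul _ _ _).trans (rng_inv b).symm) = a := by
  rw [mul_assoc a b (inv b) h (rng_inv b).symm, mul_congr rfl (mul_inv b), mul_congr rfl h.symm,
    mul_src]

/-- The product `UV` of two sets of arrows. -/
def setMul (U V : Set G) : Set G := {a | ∃ x ∈ U, ∃ y ∈ V, ∃ h : src x = rng y, mul x y h = a}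

/-- A set of arrows on which the source and range maps are injective. -/
def IsBisection (U : Set G) : Prop := Set.InjOn src U ∧ Set.InjOn rng U

theorem setMul_bisection {U V : Set G} (hU : IsBisection U) (hV : IsBisection V) :
    IsBisection (setMul U V) := by
  constructor
  · rintro _ ⟨x, hx, y, hy, h, rfl⟩ _ ⟨x', hx', y', hy', h', rfl⟩ e
    rw [src_mul, src_mul] at e
    obtain rfl := hV.1 hy hy' e
    obtain rfl := hU.1 hx hx' (h.trans h'.symm)
    rfl
  · rintro _ ⟨x, hx, y, hy, h, rfl⟩ _ ⟨x', hx', y', hy', h', rfl⟩ e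
    rw [rng_mul, rng_mul] at e
    obtain rfl := hU.2 hx hx' e
    obtain rfl := hV.2 hy hy' (h.symm.trans h')
    rfl

theorem setMul_assoc (U V W : Set G) : setMul (setMul U V) W = setMul U (setMul V W) := by
  ext a
  constructor
  · rintro ⟨_, ⟨x, hx, y, hy, h, rfl⟩, z, hz, h', rfl⟩
    have h'' : src y = rng z := (src_mul x y h).symm.trans h'
    exact ⟨x, hx, _, ⟨y, hy, z, hz, h'', rfl⟩, h.trans (rng_mul y z h'').symm,
      (mul_assoc x y z h h'').symm⟩
  · rintro ⟨x, hx, _, ⟨y, hy, z, hz, h, rfl⟩, h', rfl⟩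
    have h'' : src x = rng y := h'.trans (rng_mul y z h)
    exact ⟨_, ⟨x, hx, y, hy, h'', rfl⟩, z, hz, (src_mul x y h'').trans h,
      mul_assoc x y z h'' h⟩

variable (G) [TopologicalSpace G]

/-- An ample groupoid: a topological groupoid (the product and the inversion are continuous) that
is étale (the source map is a local homeomorphism onto the unit space), and whose unit space is
Hausdorff and admits a basis of compact-open sets. -/
class IsAmple : Prop where
  continuous_mul : Continuous fun p : Composable G => mul p.1.1 p.1.2 p.2
  continuous_inv : Continuous (inv : G → G)
  isLocalHomeomorph_src : IsLocalHomeomorph (srcUnit : G → units G)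
  t2Space_units : T2Space (units G)
  basis_units : TopologicalSpace.IsTopologicalBasis {U : Set (units G) | IsOpen U ∧ IsCompact U}

variable {G}

/-- Compact-open bisections. -/
def IsCompactOpenBisection (U : Set G) : Prop := IsOpen U ∧ IsCompact U ∧ IsBisection U

theorem continuous_src [IsAmple G] : Continuous (src : G → G) :=
  continuous_subtype_val.comp (IsAmple.isLocalHomeomorph_src (G := G)).continuous

theorem continuous_rng [IsAmple G] : Continuous (rng : G → G) := by
  have : (rng : G → G) = src ∘ inv := by
    ext a; exact (src_inv a).symm
  rw [this]
  exact continuous_src.comp IsAmple.continuous_inv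

theorem isClosed_composable [IsAmple G] : IsClosed {p : G × G | src p.1 = rng p.2} := by
  have := IsAmple.t2Space_units (G := G)
  have h1 : Continuous fun p : G × G => srcUnit p.1 :=
    (IsAmple.isLocalHomeomorph_src (G := G)).continuous.comp continuous_fst
  have h2 : Continuous fun p : G × G => srcUnit (inv p.2) :=
    (IsAmple.isLocalHomeomorph_src (G := G)).continuous.comp
      (IsAmple.continuous_inv.comp continuous_snd)
  convert isClosed_eq h1 h2 using 1
  ext p
  change src p.1 = rng p.2 ↔ srcUnit p.1 = srcUnit (inv p.2)
  rw [srcUnit_eq_iff, src_inv]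

theorem setMul_compact [IsAmple G] {U V : Set G} (hU : IsCompact U) (hV : IsCompact V) :
    IsCompact (setMul U V) := by
  have hK : IsCompact ((Subtype.val : Composable G → G × G) ⁻¹' (U ×ˢ V)) :=
    isClosed_composable.isClosedEmbedding_subtypeVal.isCompact_preimage (hU.prod hV)
  convert hK.image IsAmple.continuous_mul using 1
  ext a
  constructor
  · rintro ⟨x, hx, y, hy, h, rfl⟩
    exact ⟨⟨(x, y), h⟩, ⟨hx, hy⟩, rfl⟩
  · rintro ⟨⟨⟨x, y⟩, h⟩, ⟨hx, hy⟩, rfl⟩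
    exact ⟨x, hx, y, hy, h, rfl⟩

theorem setMul_open [IsAmple G] {U V : Set G} (hU : IsOpen U) (hV : IsOpen V) :
    IsOpen (setMul U V) := by
  rw [isOpen_iff_mem_nhds]
  rintro _ ⟨x, hx, y, hy, h, rfl⟩
  obtain ⟨e, hye, he⟩ := IsAmple.isLocalHomeomorph_src (G := G) y
  have hsc : Continuous (srcUnit : G → units G) :=
    (IsAmple.isLocalHomeomorph_src (G := G)).continuous
  set D : Set G := srcUnit ⁻¹' e.target with hD
  have hDo : IsOpen D := e.open_target.preimage hsc
  have hes : ∀ d ∈ D, src (e.symm (srcUnit d)) = src d := by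
    intro d hd
    have h1 : e (e.symm (srcUnit d)) = srcUnit d := e.right_inv hd
    rw [← he] at h1
    exact congrArg Subtype.val h1
  have hσ : Continuous fun d : D => e.symm (srcUnit d.1) := by
    have : ContinuousOn (e.symm ∘ srcUnit) D :=
      e.continuousOn_symm.comp hsc.continuousOn (fun d hd => hd)
    exact continuousOn_iff_continuous_domRestrict.1 this
  let φ : D → Composable G := fun d => ⟨(d.1, inv (e.symm (srcUnit d.1))), by
    change src d.1 = rng (inv (e.symm (srcUnit d.1)))
    rw [rng_inv, hes _ d.2]⟩
  have hφ : Continuous φ :=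
    (continuous_subtype_val.prodMk (IsAmple.continuous_inv.comp hσ)).subtype_mk _
  have hψ : Continuous fun d : D => mul (φ d).1.1 (φ d).1.2 (φ d).2 :=
    IsAmple.continuous_mul.comp hφ
  have hO : IsOpen ((Subtype.val : D → G) ''
      ((fun d : D => mul (φ d).1.1 (φ d).1.2 (φ d).2) ⁻¹' U ∩
        (fun d : D => e.symm (srcUnit d.1)) ⁻¹' V)) :=
    hDo.isOpenMap_subtype_val _ ((hU.preimage hψ).inter (hV.preimage hσ))
  refine Filter.mem_of_superset (hO.mem_nhds ?_) ?_
  · have hm : srcUnit (mul x y h) = e y := by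
      rw [← he, srcUnit_eq_iff, src_mul]
    have hmD : mul x y h ∈ D := by
      change srcUnit (mul x y h) ∈ e.target
      rw [hm]; exact e.map_source hye
    have hyy : e.symm (srcUnit (mul x y h)) = y := by
      rw [hm]; exact e.left_inv hye
    refine ⟨⟨mul x y h, hmD⟩, ⟨?_, ?_⟩, rfl⟩
    · change mul (mul x y h) (inv (e.symm (srcUnit (mul x y h)))) _ ∈ U
      have hk : ∀ (z : G) (hz : src (mul x y h) = rng (inv z)), z = y →
          mul (mul x y h) (inv z) hz = x := by
        rintro z hz rfl
        exact mul_mul_inv x z h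
      rw [hk _ _ hyy]
      exact hx
    · change e.symm (srcUnit (mul x y h)) ∈ V
      rw [hyy]; exact hy
  · rintro _ ⟨d, ⟨h1, h2⟩, rfl⟩
    exact ⟨_, h1, _, h2, _, mul_inv_cancel d.1 _ (hes d.1 d.2).symm⟩

theorem setMul_compactOpenBisection [IsAmple G] {U V : Set G} (hU : IsCompactOpenBisection U)
    (hV : IsCompactOpenBisection V) : IsCompactOpenBisection (setMul U V) :=
  ⟨setMul_open hU.1 hV.1, setMul_compact hU.2.1 hV.2.1, setMul_bisection hU.2.2 hV.2.2⟩

end ArrowGroupoid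

section Steinberg

open ArrowGroupoid

variable {R G : Type*} [CommRing R] [ArrowGroupoid G]

/-- The convolution `(f * g)(a) = ∑_{x y = a} f(x) g(y)`. -/
noncomputable def convolution (f g : G → R) : G → R := fun a =>
  ∑ᶠ p : {p : Composable G // mul p.1.1 p.1.2 p.2 = a}, f p.1.1.1 * g p.1.1.2

theorem zero_convolution (g : G → R) : convolution 0 g = 0 := by
  ext a; simp [convolution]

theorem convolution_zero (f : G → R) : convolution f 0 = 0 := by
  ext a; simp [convolution]

theorem convolution_indicator {U V : Set G} (hU : IsBisection U) (hV : IsBisection V) :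
    convolution (U.indicator (1 : G → R)) (V.indicator 1) = (setMul U V).indicator 1 := by
  ext a
  by_cases ha : a ∈ setMul U V
  · obtain ⟨x, hx, y, hy, h, rfl⟩ := ha
    rw [Set.indicator_of_mem (show mul x y h ∈ setMul U V from ⟨x, hx, y, hy, h, rfl⟩)]
    simp only [convolution]
    rw [finsum_eq_single _ ⟨⟨(x, y), h⟩, rfl⟩]
    · simp [hx, hy]
    · rintro ⟨⟨⟨x', y'⟩, h'⟩, hp⟩ hne
      by_contra hne'
      have hxU : x' ∈ U := Set.mem_of_indicator_ne_zero (left_ne_zero_of_mul hne')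
      have hyV : y' ∈ V := Set.mem_of_indicator_ne_zero (right_ne_zero_of_mul hne')
      simp only at hp
      apply hne
      obtain rfl := hU.2 hx hxU (by rw [← rng_mul x y h, ← hp, rng_mul])
      obtain rfl := hV.1 hy hyV (by rw [← src_mul x y h, ← hp, src_mul])
      rfl
  · rw [Set.indicator_of_notMem ha]
    refine finsum_eq_zero_of_forall_eq_zero ?_
    rintro ⟨⟨⟨x, y⟩, h⟩, hp⟩
    by_contra hne
    exact ha ⟨x, Set.mem_of_indicator_ne_zero (left_ne_zero_of_mul hne), y,
      Set.mem_of_indicator_ne_zero (right_ne_zero_of_mul hne), h, hp⟩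

variable (R G) [TopologicalSpace G]

/-- The `R`-submodule of `R^G` spanned by the characteristic functions of the compact-open
bisections of `G`. -/
def steinbergSubmodule : Submodule R (G → R) :=
  Submodule.span R {f | ∃ U : Set G, IsCompactOpenBisection U ∧ f = U.indicator 1}

/-- The Steinberg algebra `A_R(G)`. Its product is the convolution. -/
def SteinbergAlgebra : Type _ := steinbergSubmodule R G

variable {R G}

theorem finite_support_of_mem {f : G → R} (hf : f ∈ steinbergSubmodule R G) (g : G → R) (a : G) :
    (Function.support fun p : {p : Composable G // mul p.1.1 p.1.2 p.2 = a} =>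
      f p.1.1.1 * g p.1.1.2).Finite := by
  suffices h : (Function.support fun p : {p : Composable G // mul p.1.1 p.1.2 p.2 = a} =>
      f p.1.1.1).Finite from h.subset (Function.support_mul_subset_left _ _)
  induction hf using Submodule.span_induction with
  | mem f hf =>
    obtain ⟨U, hU, rfl⟩ := hf
    refine Set.Subsingleton.finite ?_
    rintro ⟨⟨⟨x, y⟩, h⟩, hp⟩ hx ⟨⟨⟨x', y'⟩, h'⟩, hp'⟩ hx'
    have hxU : x ∈ U := Set.mem_of_indicator_ne_zero hx
    have hxU' : x' ∈ U := Set.mem_of_indicator_ne_zero hx'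
    simp only at hp hp'
    have hr : rng x = rng x' := by rw [← rng_mul x y h, hp, ← hp', rng_mul]
    obtain rfl := hU.2.2.2 hxU hxU' hr
    have hy : y = y' := by
      have key : ∀ (y : G) (h : src x = rng y) (a : G) (_ : mul x y h = a)
          (h'' : src (inv x) = rng a), mul (inv x) a h'' = y := by
        rintro y h _ rfl h''
        rw [← ArrowGroupoid.mul_assoc (inv x) x y (src_inv x) h,
          mul_congr (inv_mul x) rfl, mul_congr h rfl, rng_mul_self]
      have h'' : src (inv x) = rng a := by rw [← hp, rng_mul, src_inv]
      rw [← key y h a hp h'', ← key y' h' a hp' h'']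
    subst hy
    rfl
  | zero => simp
  | add f g _ _ hf hg =>
    exact (hf.union hg).subset (Function.support_add _ _)
  | smul r f _ hf =>
    exact hf.subset (Function.support_const_smul_subset r _)

theorem convolution_add_left {f f' : G → R} (hf : f ∈ steinbergSubmodule R G)
    (hf' : f' ∈ steinbergSubmodule R G) (g : G → R) :
    convolution (f + f') g = convolution f g + convolution f' g := by
  ext a
  simp only [convolution, Pi.add_apply, add_mul]
  exact finsum_add_distrib (finite_support_of_mem hf g a) (finite_support_of_mem hf' g a)

theorem convolution_add_right {f : G → R} (hf : f ∈ steinbergSubmodule R G) (g g' : G → R) :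
    convolution f (g + g') = convolution f g + convolution f g' := by
  ext a
  simp only [convolution, Pi.add_apply, mul_add]
  exact finsum_add_distrib (finite_support_of_mem hf g a) (finite_support_of_mem hf g' a)

theorem convolution_smul_left (r : R) {f : G → R} (hf : f ∈ steinbergSubmodule R G) (g : G → R) :
    convolution (r • f) g = r • convolution f g := by
  ext a
  simp only [convolution, Pi.smul_apply, smul_mul_assoc]
  exact (smul_finsum' r (finite_support_of_mem hf g a)).symm

theorem convolution_smul_right (r : R) {f : G → R} (hf : f ∈ steinbergSubmodule R G) (g : G → R) :
    convolution f (r • g) = r • convolution f g := by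
  ext a
  simp only [convolution, Pi.smul_apply, mul_smul_comm]
  exact (smul_finsum' r (finite_support_of_mem hf g a)).symm

theorem indicator_mem_steinberg {U : Set G} (hU : IsCompactOpenBisection U) :
    U.indicator (1 : G → R) ∈ steinbergSubmodule R G :=
  Submodule.subset_span ⟨U, hU, rfl⟩

theorem convolution_mem [IsAmple G] {f g : G → R} (hf : f ∈ steinbergSubmodule R G)
    (hg : g ∈ steinbergSubmodule R G) : convolution f g ∈ steinbergSubmodule R G := by
  induction hf using Submodule.span_induction with
  | mem f hf =>
    obtain ⟨U, hU, rfl⟩ := hf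
    induction hg using Submodule.span_induction with
    | mem g hg =>
      obtain ⟨V, hV, rfl⟩ := hg
      rw [convolution_indicator hU.2.2 hV.2.2]
      exact indicator_mem_steinberg (setMul_compactOpenBisection hU hV)
    | zero => rw [convolution_zero]; exact zero_mem _
    | add g g' _ _ h h' =>
      rw [convolution_add_right (indicator_mem_steinberg hU)]; exact add_mem h h'
    | smul r g _ h =>
      rw [convolution_smul_right r (indicator_mem_steinberg hU)]
      exact Submodule.smul_mem _ r h
  | zero => rw [zero_convolution]; exact zero_mem _
  | add f f' hf hf' h h' => rw [convolution_add_left hf hf']; exact add_mem h h'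
  | smul r f hf h => rw [convolution_smul_left r hf]; exact Submodule.smul_mem _ r h

theorem convolution_assoc [IsAmple G] {f g k : G → R} (hf : f ∈ steinbergSubmodule R G)
    (hg : g ∈ steinbergSubmodule R G) (hk : k ∈ steinbergSubmodule R G) :
    convolution (convolution f g) k = convolution f (convolution g k) := by
  induction hf using Submodule.span_induction with
  | mem f hf =>
    obtain ⟨U, hU, rfl⟩ := hf
    have hUm := indicator_mem_steinberg (R := R) hU
    induction hg using Submodule.span_induction with
    | mem g hg =>
      obtain ⟨V, hV, rfl⟩ := hg
      have hVm := indicator_mem_steinberg (R := R) hV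
      have hUV := convolution_mem hUm hVm
      induction hk using Submodule.span_induction with
      | mem k hk =>
        obtain ⟨W, hW, rfl⟩ := hk
        rw [convolution_indicator hU.2.2 hV.2.2, convolution_indicator hV.2.2 hW.2.2,
          convolution_indicator (setMul_bisection hU.2.2 hV.2.2) hW.2.2,
          convolution_indicator hU.2.2 (setMul_bisection hV.2.2 hW.2.2), setMul_assoc]
      | zero => simp only [convolution_zero]
      | add k k' _ _ h h' =>
        rw [convolution_add_right hUV, convolution_add_right hVm, convolution_add_right hUm, h, h']
      | smul r k _ h =>
        rw [convolution_smul_right r hUV, convolution_smul_right r hVm,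
          convolution_smul_right r hUm, h]
    | zero => simp only [convolution_zero, zero_convolution]
    | add g g' hg hg' h h' =>
      rw [convolution_add_right hUm, convolution_add_left hg hg', convolution_add_right hUm,
        convolution_add_left (convolution_mem hUm hg) (convolution_mem hUm hg'), h, h']
    | smul r g hg h =>
      rw [convolution_smul_right r hUm, convolution_smul_left r hg, convolution_smul_right r hUm,
        convolution_smul_left r (convolution_mem hUm hg), h]
  | zero => simp only [zero_convolution]
  | add f f' hf hf' h h' =>
    rw [convolution_add_left hf hf', convolution_add_left hf hf',
      convolution_add_left (convolution_mem hf hg) (convolution_mem hf' hg), h, h']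
  | smul r f hf h =>
    rw [convolution_smul_left r hf, convolution_smul_left r hf,
      convolution_smul_left r (convolution_mem hf hg), h]

namespace SteinbergAlgebra

instance : AddCommGroup (SteinbergAlgebra R G) :=
  inferInstanceAs (AddCommGroup (steinbergSubmodule R G))

instance : Module R (SteinbergAlgebra R G) :=
  inferInstanceAs (Module R (steinbergSubmodule R G))

/-- The function on `G` underlying an element of the Steinberg algebra. -/
def toFun (f : SteinbergAlgebra R G) : G → R := f.1

theorem toFun_mem (f : SteinbergAlgebra R G) : f.toFun ∈ steinbergSubmodule R G := f.2

theorem ext {f g : SteinbergAlgebra R G} (h : f.toFun = g.toFun) : f = g := Subtype.ext h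

theorem toFun_zero : (0 : SteinbergAlgebra R G).toFun = 0 := rfl

theorem toFun_add (f g : SteinbergAlgebra R G) : (f + g).toFun = f.toFun + g.toFun := rfl

theorem toFun_smul (r : R) (f : SteinbergAlgebra R G) : (r • f).toFun = r • f.toFun := rfl

variable [IsAmple G]

noncomputable instance : Mul (SteinbergAlgebra R G) :=
  ⟨fun f g => ⟨convolution f.toFun g.toFun, convolution_mem f.toFun_mem g.toFun_mem⟩⟩

theorem toFun_mul (f g : SteinbergAlgebra R G) :
    (f * g).toFun = convolution f.toFun g.toFun := rfl

noncomputable instance : NonUnitalRing (SteinbergAlgebra R G) where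
  left_distrib f g h := ext (by
    simp only [toFun_mul, toFun_add, convolution_add_right f.toFun_mem])
  right_distrib f g h := ext (by
    simp only [toFun_mul, toFun_add, convolution_add_left f.toFun_mem g.toFun_mem])
  zero_mul f := ext (by simp only [toFun_mul, toFun_zero, zero_convolution])
  mul_zero f := ext (by simp only [toFun_mul, toFun_zero, convolution_zero])
  mul_assoc f g h := ext (convolution_assoc f.toFun_mem g.toFun_mem h.toFun_mem)

instance : IsScalarTower R (SteinbergAlgebra R G) (SteinbergAlgebra R G) :=
  ⟨fun r f g => ext (by
    simp only [smul_eq_mul, toFun_mul, toFun_smul, convolution_smul_left r f.toFun_mem])⟩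

instance : SMulCommClass R (SteinbergAlgebra R G) (SteinbergAlgebra R G) :=
  ⟨fun r f g => ext (by
    simp only [smul_eq_mul, toFun_mul, toFun_smul, convolution_smul_right r f.toFun_mem])⟩

end SteinbergAlgebra

variable (R G) in
/-- The diagonal subalgebra `D_R(G)`, that is, the functions in the Steinberg algebra with support
contained in the unit space. -/
def steinbergDiagonal : AddSubgroup (SteinbergAlgebra R G) where
  carrier := {f | Function.support f.toFun ⊆ units G}
  zero_mem' := by
    simp [SteinbergAlgebra.toFun_zero]
  add_mem' := fun {f g} hf hg => (Function.support_add f.toFun g.toFun).trans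
    (Set.union_subset hf hg)
  neg_mem' := fun {f} hf => (Function.support_neg f.toFun).trans_subset hf

end Steinberg

namespace TopPartialAction

open InverseSemigroup

variable {S X : Type*} [InverseSemigroup S] [TopologicalSpace X] (θ : TopPartialAction S X)

theorem mem_dom_mul {s t : S} {x : X} (hx : x ∈ θ.dom t⁻¹) (h : θ.map t x ∈ θ.dom s⁻¹) :
    x ∈ θ.dom (s * t)⁻¹ := (θ.map_comp s t x hx h).1

theorem map_mem' {s : S} {x : X} (hx : x ∈ θ.dom s⁻¹) : θ.map s x ∈ θ.dom s⁻¹⁻¹ := by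
  rw [inv_inv']; exact θ.map_mem hx

theorem mem_dom_inv_mul {s : S} {x : X} (hx : x ∈ θ.dom s⁻¹) : x ∈ θ.dom (s⁻¹ * s)⁻¹ :=
  θ.mem_dom_mul hx (θ.map_mem' hx)

theorem mem_dom_mul_inv {s : S} {x : X} (hx : x ∈ θ.dom s⁻¹) :
    θ.map s x ∈ θ.dom (s * s⁻¹)⁻¹ :=
  θ.mem_dom_mul (θ.map_mem' hx) (by rw [θ.map_inv_map hx]; exact hx)

theorem map_idem' {e : S} (he : e * e = e) {x : X} (hx : x ∈ θ.dom e⁻¹) : θ.map e x = x :=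
  θ.map_idem he (by rwa [inv_of_idem he] at hx)

/-- The set `S ∗ X` of the pairs `(s, x)` with `x ∈ X_{s⁻¹}`. -/
def Pair : Type _ := {p : S × X // p.2 ∈ θ.dom p.1⁻¹}

/-- The germ relation on `S ∗ X`: `(s, x) ∼ (t, y)` if `x = y` and there is `u ≤ s, t`
with `x ∈ X_{u⁻¹}`. -/
def germSetoid : Setoid θ.Pair where
  r p q := p.1.2 = q.1.2 ∧ ∃ u : S, NatLE u p.1.1 ∧ NatLE u q.1.1 ∧ p.1.2 ∈ θ.dom u⁻¹
  iseqv := by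
    refine ⟨fun p => ⟨rfl, p.1.1, natLE_refl _, natLE_refl _, p.2⟩, ?_, ?_⟩
    · rintro p q ⟨h, u, h1, h2, h3⟩
      exact ⟨h.symm, u, h2, h1, h ▸ h3⟩
    · rintro p q r ⟨h, u, h1, h2, h3⟩ ⟨h', v, h1', h2', h3'⟩
      rw [← h] at h3'
      refine ⟨h.trans h', u * (v⁻¹ * v), ?_, ?_, ?_⟩
      · exact natLE_trans (natLE_mul_idem u (idem_inv_mul v)) h1
      · refine natLE_trans ?_ h2'
        have h4 : NatLE (u * (v⁻¹ * v)) (q.1.1 * (v⁻¹ * v)) := natLE_mul h2 (natLE_refl _)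
        have h5 : q.1.1 * (v⁻¹ * v) = v := by rw [← mul_assoc]; exact h1'.symm
        rwa [h5] at h4
      · refine θ.mem_dom_mul (θ.mem_dom_inv_mul h3') ?_
        rw [θ.map_idem' (idem_inv_mul v) (θ.mem_dom_inv_mul h3')]
        exact h3

/-- The set `S ⋉ X` of germs. -/
def Germ : Type _ := Quotient θ.germSetoid

/-- The germ `[s, x]`. -/
def germ (s : S) (x : X) (hx : x ∈ θ.dom s⁻¹) : θ.Germ := Quotient.mk θ.germSetoid ⟨(s, x), hx⟩

theorem germ_eq_iff {s t : S} {x y : X} {hx : x ∈ θ.dom s⁻¹} {hy : y ∈ θ.dom t⁻¹} :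
    θ.germ s x hx = θ.germ t y hy ↔
      x = y ∧ ∃ u : S, NatLE u s ∧ NatLE u t ∧ x ∈ θ.dom u⁻¹ :=
  Quotient.eq (r := θ.germSetoid)

theorem germ_congr {s t : S} {x y : X} {hx : x ∈ θ.dom s⁻¹} {hy : y ∈ θ.dom t⁻¹} (h : s = t)
    (h' : x = y) : θ.germ s x hx = θ.germ t y hy := by
  subst h h'; rfl

theorem germ_eq_of_le {u s : S} (h : NatLE u s) {x : X} (hu : x ∈ θ.dom u⁻¹)
    (hs : x ∈ θ.dom s⁻¹) : θ.germ u x hu = θ.germ s x hs :=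
  θ.germ_eq_iff.2 ⟨rfl, u, natLE_refl u, h, hu⟩

theorem germ_idem_eq {e f : S} (he : e * e = e) (hf : f * f = f) {x y : X} (h : x = y)
    (hx : x ∈ θ.dom e⁻¹) (hy : y ∈ θ.dom f⁻¹) : θ.germ e x hx = θ.germ f y hy := by
  subst h
  refine θ.germ_eq_iff.2 ⟨rfl, e * f, natLE_mul_idem e hf, natLE_idem_mul f he, ?_⟩
  exact θ.mem_dom_mul hy (by rw [θ.map_idem' hf hy]; exact hx)

theorem germ_cases (a : θ.Germ) : ∃ s x hx, a = θ.germ s x hx := by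
  induction a using Quotient.inductionOn with
  | h p => exact ⟨p.1.1, p.1.2, p.2, rfl⟩

namespace Germ

variable {θ}

/-- The point `x` of a germ `[s, x]`. -/
def pt : θ.Germ → X := Quotient.lift (fun p : θ.Pair => p.1.2) fun _ _ h => h.1

theorem pt_germ (s : S) (x : X) (hx : x ∈ θ.dom s⁻¹) : (θ.germ s x hx).pt = x := rfl

/-- The point `θ_s x`, for a germ `[s, x]`. -/
def rngPt : θ.Germ → X := Quotient.lift (fun p : θ.Pair => θ.map p.1.1 p.1.2) (by
  rintro ⟨⟨s, x⟩, hx⟩ ⟨⟨t, y⟩, hy⟩ ⟨h, u, h1, h2, h3⟩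
  dsimp only at h h1 h2 h3 ⊢
  subst h
  rw [(θ.map_mono _ _ h1 x h3).2, (θ.map_mono _ _ h2 x h3).2])

theorem rngPt_germ (s : S) (x : X) (hx : x ∈ θ.dom s⁻¹) :
    (θ.germ s x hx).rngPt = θ.map s x := rfl

/-- The source of `[s, x]` is the unit `[s⁻¹ s, x]`. -/
def src : θ.Germ → θ.Germ :=
  Quotient.lift (fun p : θ.Pair => θ.germ (p.1.1⁻¹ * p.1.1) p.1.2 (θ.mem_dom_inv_mul p.2))
    fun _ _ h => θ.germ_idem_eq (idem_inv_mul _) (idem_inv_mul _) h.1 _ _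

theorem src_germ (s : S) (x : X) (hx : x ∈ θ.dom s⁻¹) :
    (θ.germ s x hx).src = θ.germ (s⁻¹ * s) x (θ.mem_dom_inv_mul hx) := rfl

/-- The range of `[s, x]` is the unit `[s s⁻¹, θ_s x]`. -/
def rng : θ.Germ → θ.Germ :=
  Quotient.lift
    (fun p : θ.Pair => θ.germ (p.1.1 * p.1.1⁻¹) (θ.map p.1.1 p.1.2) (θ.mem_dom_mul_inv p.2))
    fun _ _ h => θ.germ_idem_eq (idem_mul_inv _) (idem_mul_inv _)
      (congrArg rngPt (Quotient.sound (s := θ.germSetoid) h)) _ _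

theorem rng_germ (s : S) (x : X) (hx : x ∈ θ.dom s⁻¹) :
    (θ.germ s x hx).rng = θ.germ (s * s⁻¹) (θ.map s x) (θ.mem_dom_mul_inv hx) := rfl

/-- The inverse of `[s, x]` is `[s⁻¹, θ_s x]`. -/
def inv : θ.Germ → θ.Germ :=
  Quotient.lift (fun p : θ.Pair => θ.germ p.1.1⁻¹ (θ.map p.1.1 p.1.2) (θ.map_mem' p.2)) (by
    rintro ⟨⟨s, x⟩, hx⟩ ⟨⟨t, y⟩, hy⟩ ⟨h, u, h1, h2, h3⟩
    dsimp only at h h1 h2 h3 ⊢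
    subst h
    have e1 := (θ.map_mono _ _ h1 x h3).2
    have e2 := (θ.map_mono _ _ h2 x h3).2
    refine θ.germ_eq_iff.2 ⟨e1.trans e2.symm, u⁻¹, natLE_inv h1, natLE_inv h2, ?_⟩
    rw [e1]
    exact θ.map_mem' h3)

theorem inv_germ (s : S) (x : X) (hx : x ∈ θ.dom s⁻¹) :
    (θ.germ s x hx).inv = θ.germ s⁻¹ (θ.map s x) (θ.map_mem' hx) := rfl

theorem src_eq_rng_iff {a b : θ.Germ} : a.src = b.rng ↔ a.pt = b.rngPt := by
  obtain ⟨s, x, hx, rfl⟩ := θ.germ_cases a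
  obtain ⟨t, y, hy, rfl⟩ := θ.germ_cases b
  rw [src_germ, rng_germ, pt_germ, rngPt_germ]
  exact ⟨fun h => (θ.germ_eq_iff.1 h).1,
    fun h => θ.germ_idem_eq (idem_inv_mul _) (idem_mul_inv _) h _ _⟩

theorem src_eq_src_iff {a b : θ.Germ} : a.src = b.src ↔ a.pt = b.pt := by
  obtain ⟨s, x, hx, rfl⟩ := θ.germ_cases a
  obtain ⟨t, y, hy, rfl⟩ := θ.germ_cases b
  rw [src_germ, src_germ, pt_germ, pt_germ]
  exact ⟨fun h => (θ.germ_eq_iff.1 h).1,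
    fun h => θ.germ_idem_eq (idem_inv_mul _) (idem_inv_mul _) h _ _⟩

theorem mul_aux (a b : θ.Germ) (h : a.src = b.rng) :
    ∃ c : θ.Germ, ∀ s x hx t y hy, a = θ.germ s x hx → b = θ.germ t y hy →
      ∃ h', c = θ.germ (s * t) y h' := by
  obtain ⟨s, x, hx, rfl⟩ := θ.germ_cases a
  obtain ⟨t, y, hy, rfl⟩ := θ.germ_cases b
  rw [src_eq_rng_iff] at h
  have h : x = θ.map t y := h
  refine ⟨θ.germ (s * t) y (θ.mem_dom_mul hy (h ▸ hx)), ?_⟩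
  intro s' x' hx' t' y' hy' e e'
  obtain ⟨e1, u, h1, h2, h3⟩ := θ.germ_eq_iff.1 e
  obtain ⟨e1', v, h1', h2', h3'⟩ := θ.germ_eq_iff.1 e'
  subst e1 e1'
  have e2 := (θ.map_mono _ _ h1' y h3').2
  have e3 := (θ.map_mono _ _ h2' y h3').2
  have h4 : θ.map t' y ∈ θ.dom s'⁻¹ := by rw [e3, ← e2, ← h]; exact hx'
  refine ⟨θ.mem_dom_mul hy' h4, θ.germ_eq_iff.2 ⟨rfl, u * v, natLE_mul h1 h1',
    natLE_mul h2 h2', θ.mem_dom_mul h3' ?_⟩⟩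
  rw [← e2, ← h]
  exact h3

/-- The product `[s, θ_t y] [t, y] = [s t, y]`; see `mul_germ`. -/
noncomputable def mul (a b : θ.Germ) (h : a.src = b.rng) : θ.Germ := (mul_aux a b h).choose

theorem mul_germ {s t : S} {x y : X} (hx : x ∈ θ.dom s⁻¹) (hy : y ∈ θ.dom t⁻¹)
    (h : (θ.germ s x hx).src = (θ.germ t y hy).rng) :
    ∃ h', mul (θ.germ s x hx) (θ.germ t y hy) h = θ.germ (s * t) y h' :=
  (mul_aux _ _ h).choose_spec s x hx t y hy rfl rfl

noncomputable instance : ArrowGroupoid θ.Germ where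
  src := src
  rng := rng
  inv := inv
  mul := mul
  src_mul a b h := by
    obtain ⟨s, x, hx, rfl⟩ := θ.germ_cases a
    obtain ⟨t, y, hy, rfl⟩ := θ.germ_cases b
    obtain ⟨h', e⟩ := mul_germ hx hy h
    rw [e, src_eq_src_iff]
    rfl
  rng_mul a b h := by
    obtain ⟨s, x, hx, rfl⟩ := θ.germ_cases a
    obtain ⟨t, y, hy, rfl⟩ := θ.germ_cases b
    obtain ⟨h', e⟩ := mul_germ hx hy h
    have h := src_eq_rng_iff.1 h
    rw [pt_germ, rngPt_germ] at h
    rw [e, rng_germ, rng_germ]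
    refine θ.germ_idem_eq (idem_mul_inv _) (idem_mul_inv _) ?_ _ _
    rw [(θ.map_comp s t y hy (h ▸ hx)).2, h]
  src_inv a := by
    obtain ⟨s, x, hx, rfl⟩ := θ.germ_cases a
    rw [inv_germ, src_eq_rng_iff]
    rfl
  rng_inv a := by
    obtain ⟨s, x, hx, rfl⟩ := θ.germ_cases a
    rw [inv_germ, eq_comm, src_eq_rng_iff, rngPt_germ, θ.map_inv_map hx]
    rfl
  rng_src a := by
    obtain ⟨s, x, hx, rfl⟩ := θ.germ_cases a
    rw [eq_comm, src_eq_rng_iff, src_germ, rngPt_germ,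
      θ.map_idem' (idem_inv_mul s) (θ.mem_dom_inv_mul hx)]
    rfl
  src_rng a := by
    obtain ⟨s, x, hx, rfl⟩ := θ.germ_cases a
    rw [src_eq_rng_iff]
    rfl
  mul_assoc a b c h h' := by
    obtain ⟨s, x, hx, rfl⟩ := θ.germ_cases a
    obtain ⟨t, y, hy, rfl⟩ := θ.germ_cases b
    obtain ⟨u, z, hz, rfl⟩ := θ.germ_cases c
    have key : ∀ (d d' : θ.Germ) (hd : d.src = (θ.germ u z hz).rng)
        (hd' : (θ.germ s x hx).src = d'.rng),
        (∃ k, d = θ.germ (s * t) y k) → (∃ k, d' = θ.germ (t * u) z k) →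
        mul d (θ.germ u z hz) hd = mul (θ.germ s x hx) d' hd' := by
      rintro d d' hd hd' ⟨k, rfl⟩ ⟨k', rfl⟩
      obtain ⟨h1, e1⟩ := mul_germ k hz hd
      obtain ⟨h2, e2⟩ := mul_germ hx k' hd'
      rw [e1, e2]
      exact θ.germ_congr (_root_.mul_assoc s t u) rfl
    exact key _ _ _ _ (mul_germ hx hy h) (mul_germ hy hz h')
  mul_src a := by
    obtain ⟨s, x, hx, rfl⟩ := θ.germ_cases a
    have key : ∀ h, mul (θ.germ s x hx) (θ.germ (s⁻¹ * s) x (θ.mem_dom_inv_mul hx)) h =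
        θ.germ s x hx := by
      intro h
      obtain ⟨h', e⟩ := mul_germ hx (θ.mem_dom_inv_mul hx) h
      rw [e]
      exact θ.germ_congr (by rw [← _root_.mul_assoc, mul_inv_mul]) rfl
    exact key _
  rng_mul_self a := by
    obtain ⟨s, x, hx, rfl⟩ := θ.germ_cases a
    have key : ∀ h, mul (θ.germ (s * s⁻¹) (θ.map s x) (θ.mem_dom_mul_inv hx))
        (θ.germ s x hx) h = θ.germ s x hx := by
      intro h
      obtain ⟨h', e⟩ := mul_germ (θ.mem_dom_mul_inv hx) hx h
      rw [e]
      exact θ.germ_congr (mul_inv_mul s) rfl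
    exact key _
  inv_mul a := by
    obtain ⟨s, x, hx, rfl⟩ := θ.germ_cases a
    have key : ∀ h, mul (θ.germ s⁻¹ (θ.map s x) (θ.map_mem' hx)) (θ.germ s x hx) h =
        (θ.germ s x hx).src := by
      intro h
      obtain ⟨h', e⟩ := mul_germ (θ.map_mem' hx) hx h
      rw [e, src_germ]
    exact key _
  mul_inv a := by
    obtain ⟨s, x, hx, rfl⟩ := θ.germ_cases a
    have key : ∀ h, mul (θ.germ s x hx) (θ.germ s⁻¹ (θ.map s x) (θ.map_mem' hx)) h =
        (θ.germ s x hx).rng := by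
      intro h
      obtain ⟨h', e⟩ := mul_germ hx (θ.map_mem' hx) h
      rw [e, rng_germ]
    exact key _

/-- The set `[s, U]` of the germs `[s, x]` with `x ∈ U`. -/
def basic (θ : TopPartialAction S X) (s : S) (U : Set X) : Set θ.Germ :=
  {a | ∃ x, ∃ hx : x ∈ θ.dom s⁻¹, x ∈ U ∧ a = θ.germ s x hx}

/-- The topology of `S ⋉ X` generated by the sets `[s, U]` with `U ⊆ X_{s⁻¹}` open (these sets
form a basis). -/
instance : TopologicalSpace θ.Germ :=
  TopologicalSpace.generateFrom
    {V | ∃ (s : S) (U : Set X), IsOpen U ∧ U ⊆ θ.dom s⁻¹ ∧ V = basic θ s U}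

/-- The set of the points `x ∈ X_{s⁻¹}` with `[s, x] ∈ W`. -/
def slice (s : S) (W : Set θ.Germ) : Set X := {x | ∃ hx : x ∈ θ.dom s⁻¹, θ.germ s x hx ∈ W}

theorem slice_subset (s : S) (W : Set θ.Germ) : slice s W ⊆ θ.dom s⁻¹ := fun _ hx => hx.1

theorem isOpen_basic {s : S} {U : Set X} (hU : IsOpen U) (hs : U ⊆ θ.dom s⁻¹) :
    IsOpen (basic θ s U) :=
  TopologicalSpace.isOpen_generateFrom_of_mem ⟨s, U, hU, hs, rfl⟩

theorem isOpen_iff {W : Set θ.Germ} : IsOpen W ↔ ∀ s, IsOpen (slice s W) := by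
  constructor
  · intro hW s
    induction hW with
    | basic V hV =>
      obtain ⟨t, U, hU, hUt, rfl⟩ := hV
      have : slice s (basic θ t U) =
          ⋃ u ∈ {u : S | NatLE u s ∧ NatLE u t}, U ∩ θ.dom u⁻¹ := by
        ext x
        simp only [Set.mem_iUnion, Set.mem_inter_iff, exists_prop]
        constructor
        · rintro ⟨hx, y, hy, hyU, e⟩
          obtain ⟨rfl, u, h1, h2, h3⟩ := θ.germ_eq_iff.1 e
          exact ⟨u, ⟨h1, h2⟩, hyU, h3⟩
        · rintro ⟨u, ⟨h1, h2⟩, hxU, h3⟩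
          exact ⟨(θ.map_mono _ _ h1 x h3).1, x, hUt hxU, hxU,
            θ.germ_eq_iff.2 ⟨rfl, u, h1, h2, h3⟩⟩
      rw [this]
      exact isOpen_biUnion fun u _ => hU.inter (θ.isOpen_dom _)
    | univ =>
      have : slice s (Set.univ : Set θ.Germ) = θ.dom s⁻¹ := by
        ext x; exact ⟨fun h => h.1, fun h => ⟨h, trivial⟩⟩
      rw [this]; exact θ.isOpen_dom _
    | inter V V' _ _ h h' =>
      have : slice s (V ∩ V') = slice s V ∩ slice s V' := by
        ext x
        exact ⟨fun ⟨h, h1, h2⟩ => ⟨⟨h, h1⟩, ⟨h, h2⟩⟩, fun ⟨⟨h, h1⟩, ⟨_, h2⟩⟩ => ⟨h, h1, h2⟩⟩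
      rw [this]; exact h.inter h'
    | sUnion 𝒱 _ h =>
      have : slice s (⋃₀ 𝒱) = ⋃ V ∈ 𝒱, slice s V := by
        ext x
        simp only [Set.mem_iUnion, exists_prop]
        exact ⟨fun ⟨h, V, hV, hxV⟩ => ⟨V, hV, h, hxV⟩, fun ⟨V, hV, h, hxV⟩ => ⟨h, V, hV, hxV⟩⟩
      rw [this]; exact isOpen_biUnion h
  · intro h
    have : W = ⋃ s, basic θ s (slice s W) := by
      ext a
      simp only [Set.mem_iUnion]
      constructor
      · intro ha
        obtain ⟨s, x, hx, rfl⟩ := θ.germ_cases a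
        exact ⟨s, x, hx, ⟨hx, ha⟩, rfl⟩
      · rintro ⟨s, x, hx, ⟨_, h⟩, rfl⟩
        exact h
    rw [this]
    exact isOpen_iUnion fun s => isOpen_basic (h s) (slice_subset s W)

theorem continuous_pt : Continuous (pt : θ.Germ → X) := by
  refine continuous_def.2 fun O hO => isOpen_iff.2 fun s => ?_
  have : slice s (pt ⁻¹' O : Set θ.Germ) = θ.dom s⁻¹ ∩ O := by
    ext x; exact ⟨fun ⟨h, h'⟩ => ⟨h, h'⟩, fun ⟨h, h'⟩ => ⟨h, h'⟩⟩
  rw [this]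
  exact (θ.isOpen_dom _).inter hO

theorem isOpenMap_pt : IsOpenMap (pt : θ.Germ → X) := by
  intro W hW
  have : pt '' W = ⋃ s, slice s W := by
    ext x
    simp only [Set.mem_iUnion]
    constructor
    · rintro ⟨a, ha, rfl⟩
      obtain ⟨s, x, hx, rfl⟩ := θ.germ_cases a
      exact ⟨s, hx, ha⟩
    · rintro ⟨s, hx, h⟩
      exact ⟨_, h, rfl⟩
  rw [this]
  exact isOpen_iUnion fun s => isOpen_iff.1 hW s

theorem continuous_src : Continuous (src : θ.Germ → θ.Germ) := by
  refine continuous_def.2 fun W hW => isOpen_iff.2 fun s => ?_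
  have : slice s (src ⁻¹' W) = θ.dom s⁻¹ ∩ slice (s⁻¹ * s) W := by
    ext x
    exact ⟨fun ⟨h, h'⟩ => ⟨h, θ.mem_dom_inv_mul h, h'⟩, fun ⟨h, _, h'⟩ => ⟨h, h'⟩⟩
  rw [this]
  exact (θ.isOpen_dom _).inter (isOpen_iff.1 hW _)

theorem continuous_inv : Continuous (inv : θ.Germ → θ.Germ) := by
  refine continuous_def.2 fun W hW => isOpen_iff.2 fun s => ?_
  have : slice s (inv ⁻¹' W) = θ.dom s⁻¹ ∩ θ.map s ⁻¹' slice s⁻¹ W := by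
    ext x
    exact ⟨fun ⟨h, h'⟩ => ⟨h, θ.map_mem' h, h'⟩, fun ⟨h, _, h'⟩ => ⟨h, h'⟩⟩
  rw [this]
  exact (θ.continuousOn_map s).isOpen_inter_preimage (θ.isOpen_dom _) (isOpen_iff.1 hW _)

open ArrowGroupoid in
theorem continuous_mul :
    Continuous fun p : Composable θ.Germ => ArrowGroupoid.mul p.1.1 p.1.2 p.2 := by
  refine continuous_def.2 fun W hW => isOpen_iff_mem_nhds.2 ?_
  rintro ⟨⟨a, b⟩, h⟩ hp
  obtain ⟨s, x, hx, rfl⟩ := θ.germ_cases a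
  obtain ⟨t, y, hy, rfl⟩ := θ.germ_cases b
  have hO : IsOpen ((Subtype.val : Composable θ.Germ → θ.Germ × θ.Germ) ⁻¹'
      (basic θ s (θ.dom s⁻¹) ×ˢ basic θ t (θ.dom t⁻¹ ∩ slice (s * t) W))) :=
    ((isOpen_basic (θ.isOpen_dom _) subset_rfl).prod
      (isOpen_basic ((θ.isOpen_dom _).inter (isOpen_iff.1 hW _))
        Set.inter_subset_left)).preimage continuous_subtype_val
  refine Filter.mem_of_superset (hO.mem_nhds ⟨⟨x, hx, hx, rfl⟩, y, hy, ⟨hy, ?_⟩, rfl⟩) ?_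
  · obtain ⟨h', e⟩ := mul_germ hx hy h
    exact ⟨h', e ▸ hp⟩
  · rintro ⟨⟨a, b⟩, k⟩ ⟨⟨x', hx', -, e⟩, y', hy', ⟨-, h2, h3⟩, e'⟩
    dsimp only at e e'
    subst e e'
    obtain ⟨h', e⟩ := mul_germ hx' hy' k
    exact Eq.subst (motive := fun c => c ∈ W) e.symm h3

theorem pt_src (a : θ.Germ) : a.src.pt = a.pt := by
  obtain ⟨s, x, hx, rfl⟩ := θ.germ_cases a
  rfl

theorem units_ext {a b : ArrowGroupoid.units θ.Germ} (h : a.1.pt = b.1.pt) : a = b := by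
  apply Subtype.ext
  rw [← ArrowGroupoid.src_of_mem_units a.2, ← ArrowGroupoid.src_of_mem_units b.2]
  exact src_eq_src_iff.2 h

open ArrowGroupoid in
theorem isLocalHomeomorph_src :
    IsLocalHomeomorph (srcUnit : θ.Germ → units θ.Germ) := by
  have hc : Continuous (srcUnit : θ.Germ → units θ.Germ) := continuous_src.subtype_mk _
  have ho : IsOpenMap (srcUnit : θ.Germ → units θ.Germ) := by
    intro W hW
    have : srcUnit '' W = (fun u : units θ.Germ => u.1.pt) ⁻¹' (pt '' W) := by
      ext u
      constructor
      · rintro ⟨a, ha, rfl⟩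
        exact ⟨a, ha, (pt_src a).symm⟩
      · rintro ⟨a, ha, h⟩
        exact ⟨a, ha, units_ext ((pt_src a).trans h)⟩
    rw [this]
    exact (isOpenMap_pt W hW).preimage (continuous_pt.comp continuous_subtype_val)
  rw [isLocalHomeomorph_iff_isOpenEmbedding_restrict]
  intro a
  obtain ⟨s, x, hx, rfl⟩ := θ.germ_cases a
  have hB : IsOpen (basic θ s (θ.dom s⁻¹)) := isOpen_basic (θ.isOpen_dom _) subset_rfl
  refine ⟨basic θ s (θ.dom s⁻¹), hB.mem_nhds ⟨x, hx, hx, rfl⟩, ?_⟩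
  refine Topology.IsOpenEmbedding.of_continuous_injective_isOpenMap
    (hc.comp continuous_subtype_val) ?_ (ho.comp hB.isOpenMap_subtype_val)
  intro b c h
  have h' : b.1.pt = c.1.pt := src_eq_src_iff.1 (congrArg Subtype.val h)
  apply Subtype.ext
  obtain ⟨y, hy, -, hb⟩ := b.2
  obtain ⟨z, hz, -, hc⟩ := c.2
  rw [hb, hc, pt_germ, pt_germ] at h'
  rw [hb, hc]
  exact θ.germ_congr rfl h'

open ArrowGroupoid in
theorem exists_unit (x : X) {W : Set (units θ.Germ)} (hW : IsOpen W) (u : units θ.Germ)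
    (hu : u ∈ W) (hx : u.1.pt = x) :
    ∃ O : Set X, IsOpen O ∧ x ∈ O ∧ ∀ y ∈ O, ∃ v ∈ W, v.1.pt = y := by
  obtain ⟨W', hW', rfl⟩ := hW
  obtain ⟨e, he, hxe⟩ := θ.cover x
  have hu' : ∀ (y : X) (hy : y ∈ θ.dom e⁻¹), θ.germ e y hy ∈ units θ.Germ := fun y hy =>
    ⟨θ.germ e y hy, θ.germ_idem_eq (idem_inv_mul _) he rfl _ _⟩
  have hxe' : x ∈ θ.dom e⁻¹ := by rwa [inv_of_idem he]
  refine ⟨slice e W', isOpen_iff.1 hW' e, ⟨hxe', ?_⟩, ?_⟩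
  · have : u = ⟨θ.germ e x hxe', hu' x hxe'⟩ := units_ext hx
    rw [this] at hu
    exact hu
  · rintro y ⟨hy, hyW⟩
    exact ⟨⟨θ.germ e y hy, hu' y hy⟩, hyW, rfl⟩

open ArrowGroupoid in
theorem isOpenMap_pt_units : IsOpenMap fun u : units θ.Germ => u.1.pt := by
  intro W hW
  rw [isOpen_iff_mem_nhds]
  rintro x ⟨u, hu, hx⟩
  obtain ⟨O, hO, hxO, h⟩ := exists_unit x hW u hu hx
  refine Filter.mem_of_superset (hO.mem_nhds hxO) fun y hy => ?_
  obtain ⟨v, hv, hvy⟩ := h y hy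
  exact ⟨v, hv, hvy⟩

open ArrowGroupoid in
theorem isHomeomorph_pt_units : IsHomeomorph fun u : units θ.Germ => u.1.pt where
  continuous := continuous_pt.comp continuous_subtype_val
  isOpenMap := isOpenMap_pt_units
  bijective := by
    refine ⟨fun a b h => units_ext h, fun x => ?_⟩
    obtain ⟨e, he, hxe⟩ := θ.cover x
    have hxe' : x ∈ θ.dom e⁻¹ := by rwa [inv_of_idem he]
    exact ⟨srcUnit (θ.germ e x hxe'), rfl⟩

/-- `S ⋉ X` is an ample groupoid. -/
instance [LocallyCompactSpace X] [T2Space X] [ZeroDimSpace X] :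
    ArrowGroupoid.IsAmple θ.Germ where
  continuous_mul := continuous_mul
  continuous_inv := continuous_inv
  isLocalHomeomorph_src := isLocalHomeomorph_src
  t2Space_units := T2Space.of_injective_continuous isHomeomorph_pt_units.injective
    isHomeomorph_pt_units.continuous
  basis_units := by
    refine TopologicalSpace.isTopologicalBasis_of_isOpen_of_nhds (fun U hU => hU.1) ?_
    intro u W hu hW
    have hO := isOpenMap_pt_units W hW
    obtain ⟨K, hK, hKW, hKc⟩ := local_compact_nhds (hO.mem_nhds ⟨u, hu, rfl⟩)
    obtain ⟨V, hV, huV, hVK⟩ := ZeroDimSpace.basis.mem_nhds_iff.1 hK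
    have hVc : IsCompact V := hKc.of_isClosed_subset (IsClopen.isClosed hV) hVK
    refine ⟨(fun u : ArrowGroupoid.units θ.Germ => u.1.pt) ⁻¹' V, ⟨?_, ?_⟩, huV, ?_⟩
    · exact (IsClopen.isOpen hV).preimage isHomeomorph_pt_units.continuous
    · exact isHomeomorph_pt_units.isClosedEmbedding.isCompact_preimage hVc
    · intro v hv
      obtain ⟨w, hw, hwv⟩ := hKW (hVK hv)
      have : w = v := units_ext hwv
      rwa [← this]

end Germ

end TopPartialAction

/-!
The isomorphism is the inverse of the map from the crossed product to the Steinberg algebra that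
sends the class of `a δ_s` to the function `[s, x] ↦ a (θ_s x)`, extended by zero outside of
`[s, X_{s⁻¹}]`. This function does not change when `s` is replaced by a larger element, so the map
is defined on the crossed product (`preToSteinberg_eq_zero_of_mem`), and it is multiplicative
because a germ `[s t, y]` has only one factorization into a germ of `s` and a germ of `t`
(`convolution_germFun`). It is surjective since a compact-open bisection agrees with some
`[s, X_{s⁻¹}]` over a small neighbourhood of the range of each of its points, and finitely many
such neighbourhoods, made disjoint, suffice (`exists_preToSteinberg_eq_indicator`).

Injectivity is a local question on `X`: for a clopen set `W` an element `∑ a_s δ_s` can be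
restricted to `∑ (1_W a_s) δ_s`, and it is enough to treat small `W` around each point `x`
(`toCrossed_mem_of_local`). For such `W` each `a_s` is constant on `W`, and `1_W δ_s` and `1_W δ_t`
have the same class as soon as `s` and `t` have the same germ with range `x`. Hence the class of
the restriction is the linear combination of the classes of `1_W δ_{s_g}`, where `g` runs through
the germs with range `x` and `s_g` represents `g`, and the coefficient at `g` is the value at `g` of
the function on `S ⋉ X` (`exists_toCrossed_restrictPre_eq`). If that function is zero, so is the
class.

The same local formula settles the diagonals. The groupoid need not be Hausdorff, so the unit space
may fail to be closed, and a function supported on the units is not visibly a combination of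
functions `1_W δ_e`. Locally, however, only the unit germ at `x` contributes to the formula, and it
is represented by an idempotent (`toCrossed_mem_diagonal`).
-/

/-! ### Compact sets and clopen sets -/

section Compactness

open TopologicalSpace

/-- A property of clopen sets that passes to disjoint unions and holds for all small clopen sets
around each point of a compact set `K` holds for all clopen subsets of some clopen set
containing `K`. -/
theorem IsCompact.exists_clopens_forall_le {X : Type*} [TopologicalSpace X] {K : Set X}
    (hK : IsCompact K) (P : Clopens X → Prop) (hbot : P ⊥)
    (hsup : ∀ A B : Clopens X, Disjoint A B → P A → P B → P (A ⊔ B))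
    (hloc : ∀ x ∈ K, ∃ W : Clopens X, x ∈ W ∧ ∀ W' ≤ W, P W') :
    ∃ W : Clopens X, K ⊆ W ∧ ∀ W' ≤ W, P W' := by
  refine hK.induction_on (p := fun T => ∃ W : Clopens X, T ⊆ W ∧ ∀ W' ≤ W, P W') ?_ ?_ ?_ ?_
  · exact ⟨⊥, Set.empty_subset _, fun W' h => by rwa [le_bot_iff.1 h]⟩
  · rintro T T' hT ⟨W, h1, h2⟩
    exact ⟨W, hT.trans h1, h2⟩
  · rintro T T' ⟨W, h1, h2⟩ ⟨V, h1', h2'⟩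
    refine ⟨W ⊔ V, ?_, fun W' hW' => ?_⟩
    · rw [Clopens.coe_sup]; exact Set.union_subset_union h1 h1'
    · rw [← sup_inf_sdiff W' W]
      refine hsup _ _ disjoint_inf_sdiff (h2 _ inf_le_right) (h2' _ ?_)
      exact sdiff_le_iff.2 hW'
  · intro x hx
    obtain ⟨W, hxW, h⟩ := hloc x hx
    exact ⟨W, mem_nhdsWithin_of_mem_nhds (W.isOpen.mem_nhds hxW), W, subset_rfl, h⟩

theorem exists_compact_clopens {X : Type*} [TopologicalSpace X] [LocallyCompactSpace X]
    [ZeroDimSpace X] {x : X} {O : Set X} (hO : IsOpen O) (hx : x ∈ O) :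
    ∃ W : Clopens X, x ∈ W ∧ IsCompact (W : Set X) ∧ (W : Set X) ⊆ O := by
  obtain ⟨K, hK, hKO, hKc⟩ := local_compact_nhds (hO.mem_nhds hx)
  obtain ⟨V, hV, hxV, hVK⟩ := ZeroDimSpace.basis.mem_nhds_iff.1 hK
  exact ⟨⟨V, hV⟩, hxV, hKc.of_isClosed_subset (IsClopen.isClosed hV) hVK, hVK.trans hKO⟩

theorem isCompact_clopens_of_le {X : Type*} [TopologicalSpace X] {W W' : Clopens X} (h : W' ≤ W)
    (hW : IsCompact (W : Set X)) : IsCompact (W' : Set X) :=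
  hW.of_isClosed_subset W'.isClosed h

end Compactness

namespace TopPartialAction

open InverseSemigroup TopologicalSpace

variable {S X : Type*} [InverseSemigroup S] [TopologicalSpace X] {θ : TopPartialAction S X}

/-! ### Germs and their ranges -/

namespace Germ

theorem mem_basic_dom {s : S} {a : θ.Germ} :
    a ∈ basic θ s (θ.dom s⁻¹) ↔ ∃ x hx, a = θ.germ s x hx :=
  ⟨fun ⟨x, hx, _, h⟩ => ⟨x, hx, h⟩, fun ⟨x, hx, h⟩ => ⟨x, hx, hx, h⟩⟩

theorem germ_mem_basic_dom {s : S} {x : X} (hx : x ∈ θ.dom s⁻¹) :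
    θ.germ s x hx ∈ basic θ s (θ.dom s⁻¹) := ⟨x, hx, hx, rfl⟩

theorem mem_basic_dom_iff_eq {s : S} {a : θ.Germ} (h : a.rngPt ∈ θ.dom s) :
    a ∈ basic θ s (θ.dom s⁻¹) ↔ a = θ.germ s (θ.map s⁻¹ a.rngPt) (θ.map_inv_mem h) := by
  refine ⟨?_, fun e => e ▸ germ_mem_basic_dom _⟩
  rintro ⟨x, hx, -, rfl⟩
  exact θ.germ_congr rfl (θ.map_inv_map hx).symm

theorem rngPt_mem {s : S} {a : θ.Germ} (h : a ∈ basic θ s (θ.dom s⁻¹)) : a.rngPt ∈ θ.dom s := by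
  obtain ⟨x, hx, -, rfl⟩ := h
  exact θ.map_mem hx

theorem rng_eq_rng_iff {a b : θ.Germ} : a.rng = b.rng ↔ a.rngPt = b.rngPt := by
  obtain ⟨s, x, hx, rfl⟩ := θ.germ_cases a
  obtain ⟨t, y, hy, rfl⟩ := θ.germ_cases b
  rw [rng_germ, rng_germ, rngPt_germ, rngPt_germ]
  exact ⟨fun h => (θ.germ_eq_iff.1 h).1,
    fun h => θ.germ_idem_eq (idem_mul_inv _) (idem_mul_inv _) h _ _⟩

theorem continuous_rngPt : Continuous (rngPt : θ.Germ → X) := by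
  have : (rngPt : θ.Germ → X) = pt ∘ inv := by
    ext a
    obtain ⟨s, x, hx, rfl⟩ := θ.germ_cases a
    rfl
  rw [this]
  exact continuous_pt.comp continuous_inv

theorem isBisection_basic (s : S) (U : Set X) : ArrowGroupoid.IsBisection (basic θ s U) := by
  constructor
  · rintro _ ⟨x, hx, -, rfl⟩ _ ⟨y, hy, -, rfl⟩ h
    exact θ.germ_congr rfl (src_eq_src_iff.1 h)
  · rintro _ ⟨x, hx, -, rfl⟩ _ ⟨y, hy, -, rfl⟩ h
    have h' : θ.map s x = θ.map s y := rng_eq_rng_iff.1 h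
    refine θ.germ_congr rfl ?_
    rw [← θ.map_inv_map hx, h', θ.map_inv_map hy]

theorem isCompact_basic {s : S} {U : Set X} (hU : IsCompact U) (hs : U ⊆ θ.dom s⁻¹) :
    IsCompact (basic θ s U) := by
  have hc : Continuous fun x : θ.dom s⁻¹ => θ.germ s x.1 x.2 := by
    refine continuous_def.2 fun W hW => ?_
    convert (isOpen_iff.1 hW s).preimage continuous_subtype_val using 1
    ext x
    exact ⟨fun h => ⟨x.2, h⟩, fun ⟨_, h⟩ => h⟩
  have hK : IsCompact ((Subtype.val : θ.dom s⁻¹ → X) ⁻¹' U) := by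
    rw [Subtype.isCompact_iff, Set.image_preimage_eq_of_subset (by simpa using hs)]
    exact hU
  convert hK.image hc using 1
  ext a
  exact ⟨fun ⟨x, hx, h, e⟩ => ⟨⟨x, hx⟩, h, e.symm⟩, fun ⟨x, h, e⟩ => ⟨x.1, x.2, h, e.symm⟩⟩

/-- For `W ⊆ X_s` compact-open, the germs `[s, x]` with `θ_s x ∈ W` form a compact-open
bisection. -/
theorem isCompactOpenBisection_inter_rngPt [T2Space X] {s : S} {W : Clopens X}
    (hW : IsCompact (W : Set X)) (hs : (W : Set X) ⊆ θ.dom s) :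
    ArrowGroupoid.IsCompactOpenBisection (basic θ s (θ.dom s⁻¹) ∩ rngPt ⁻¹' W) := by
  have h : basic θ s (θ.dom s⁻¹) ∩ rngPt ⁻¹' W = basic θ s (θ.map s⁻¹ '' W) := by
    ext a
    constructor
    · rintro ⟨⟨x, hx, -, rfl⟩, h⟩
      exact ⟨x, hx, ⟨_, h, θ.map_inv_map hx⟩, rfl⟩
    · rintro ⟨x, hx, ⟨y, hy, e⟩, rfl⟩
      refine ⟨germ_mem_basic_dom hx, ?_⟩
      rw [Set.mem_preimage, rngPt_germ, ← e, θ.map_map_inv (hs hy)]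
      exact hy
  have hc : IsCompact (basic θ s (θ.map s⁻¹ '' W)) := by
    refine isCompact_basic (hW.image_of_continuousOn
      ((θ.continuousOn_map s⁻¹).mono (by rwa [inv_inv']))) ?_
    rintro _ ⟨y, hy, rfl⟩
    exact θ.map_inv_mem (hs hy)
  refine ⟨?_, h ▸ hc, h ▸ isBisection_basic s _⟩
  exact (isOpen_basic (θ.isOpen_dom _) subset_rfl).inter (W.isOpen.preimage continuous_rngPt)

end Germ

open TopPartialAction.Germ

/-! ### The map from formal sums to the Steinberg algebra -/

section SteinbergMap

variable (θ) {R : Type*} [CommRing R]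

/-- The function on `S ⋉ X` with value `f (θ_s x)` at the germ `[s, x]` and value `0` outside of
`[s, X_{s⁻¹}]`. -/
noncomputable def germFun (s : S) (f : X → R) : θ.Germ → R :=
  (basic θ s (θ.dom s⁻¹)).indicator (f ∘ rngPt)

variable {θ}

theorem germFun_germ {s : S} {x : X} (hx : x ∈ θ.dom s⁻¹) (f : X → R) :
    θ.germFun s f (θ.germ s x hx) = f (θ.map s x) :=
  Set.indicator_of_mem (germ_mem_basic_dom hx) _

theorem germFun_add (s : S) (f g : X → R) :
    θ.germFun s (f + g) = θ.germFun s f + θ.germFun s g :=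
  Set.indicator_add _ (f ∘ rngPt) (g ∘ rngPt)

theorem germFun_smul (s : S) (r : R) (f : X → R) :
    θ.germFun s (r • f) = r • θ.germFun s f :=
  Set.indicator_const_smul _ r (f ∘ rngPt)

theorem germFun_zero (s : S) : θ.germFun s (fun _ => (0 : R)) = 0 :=
  Set.indicator_zero _ _

theorem germFun_indicator_one (s : S) (W : Set X) :
    θ.germFun s (W.indicator (1 : X → R)) =
      (basic θ s (θ.dom s⁻¹) ∩ rngPt ⁻¹' W).indicator 1 := by
  classical
  ext a
  simp only [germFun, Set.indicator_apply, Set.mem_inter_iff, Set.mem_preimage,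
    Function.comp_apply, Pi.one_apply]
  split_ifs <;> simp_all

/-- Since `f` is locally constant, `germFun s f` is locally on `X` a multiple of the characteristic
function of a compact-open bisection. -/
theorem germFun_mem [LocallyCompactSpace X] [T2Space X] [ZeroDimSpace X] (s : S)
    (f : θ.dualIdeal R s) : θ.germFun s f.1.1 ∈ steinbergSubmodule R θ.Germ := by
  have key := f.1.2.2.exists_clopens_forall_le
    (fun W => θ.germFun s ((W : Set X).indicator f.1.1) ∈ steinbergSubmodule R θ.Germ)
  obtain ⟨W, hW, h⟩ := key (by
      rw [Clopens.coe_bot, Set.indicator_empty, germFun_zero]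
      exact zero_mem _) (by
      intro A B hAB hA hB
      rw [Clopens.coe_sup, Set.indicator_union_of_disjoint (Clopens.coe_disjoint.2 hAB)]
      exact (germFun_add s ((A : Set X).indicator f.1.1) ((B : Set X).indicator f.1.1)).symm ▸
        add_mem hA hB) (by
      intro x hx
      obtain ⟨O, hO, hxO, hf⟩ := f.1.2.1.exists_open x
      obtain ⟨W, hxW, hWc, hWO⟩ := exists_compact_clopens (hO.inter (θ.isOpen_dom s))
        ⟨hxO, f.2 hx⟩
      refine ⟨W, hxW, fun W' hW' => ?_⟩
      have : (W' : Set X).indicator f.1.1 = f.1.1 x • (W' : Set X).indicator 1 := by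
        ext y
        by_cases hy : y ∈ (W' : Set X)
        · simp [hy, hf y (hWO (hW' hy)).1]
        · simp [hy]
      rw [this, germFun_smul, germFun_indicator_one]
      exact Submodule.smul_mem _ _ (indicator_mem_steinberg
        (isCompactOpenBisection_inter_rngPt (isCompact_clopens_of_le hW' hWc)
          (fun y hy => (hWO (hW' hy)).2))))
  have := h W le_rfl
  rwa [Set.indicator_eq_self.2 hW] at this

/-- Passing from `r ≤ s` to `s` does not change the function attached to `a ∈ D_r`: a germ `[s, x]`
with `θ_s x ∈ X_r` is already `[r, x]`. -/
theorem germFun_mono {r s : S} (h : NatLE r s) {f : X → R} (hf : Function.support f ⊆ θ.dom r) :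
    θ.germFun r f = θ.germFun s f := by
  ext a
  by_cases ha : f a.rngPt = 0
  · have ha' : (f ∘ rngPt) a = 0 := ha
    simp only [germFun, Set.indicator_apply_eq_zero.2 fun _ => ha']
  · have hr : a.rngPt ∈ θ.dom r := hf ha
    have hs : a.rngPt ∈ θ.dom s := θ.dom_mono h hr
    have hi : θ.map s⁻¹ a.rngPt = θ.map r⁻¹ a.rngPt :=
      (θ.map_mono _ _ (natLE_inv h) _ (by rwa [inv_inv'])).2
    have key : a ∈ basic θ r (θ.dom r⁻¹) ↔ a ∈ basic θ s (θ.dom s⁻¹) := by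
      rw [mem_basic_dom_iff_eq hr, mem_basic_dom_iff_eq hs]
      have e : θ.germ r (θ.map r⁻¹ a.rngPt) (θ.map_inv_mem hr) =
          θ.germ s (θ.map s⁻¹ a.rngPt) (θ.map_inv_mem hs) :=
        θ.germ_eq_iff.2 ⟨hi.symm, r, natLE_refl r, h, θ.map_inv_mem hr⟩
      rw [e]
    classical
    simp only [germFun, Set.indicator_apply, key]

/-- A composable pair on which `germFun s f` and `germFun t g` do not vanish has the form
`([s, θ_t y], [t, y])`. -/
theorem exists_of_germFun_mul_ne_zero {s t : S} {f g : X → R} {p q : θ.Germ}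
    (h : p.src = q.rng) (hne : θ.germFun s f p * θ.germFun t g q ≠ 0) :
    ∃ y, ∃ hy : y ∈ θ.dom t⁻¹, ∃ hx : θ.map t y ∈ θ.dom s⁻¹,
      p = θ.germ s (θ.map t y) hx ∧ q = θ.germ t y hy := by
  obtain ⟨x, hx, rfl⟩ := mem_basic_dom.1 (Set.mem_of_indicator_ne_zero (left_ne_zero_of_mul hne))
  obtain ⟨y, hy, rfl⟩ := mem_basic_dom.1 (Set.mem_of_indicator_ne_zero (right_ne_zero_of_mul hne))
  have e : x = θ.map t y := src_eq_rng_iff.1 h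
  subst e
  exact ⟨y, hy, hx, rfl, rfl⟩

variable [T2Space X] [ZeroDimSpace X]

theorem dual_twist_apply_of_mem {s : S} (a : (θ.dual R).ideal s) (b : LocConstAlgebra R X) {x : X}
    (hx : x ∈ θ.dom s) :
    ((θ.dual R).twist s a b).1 x = a.1.1 x * b.1 (θ.map s⁻¹ x) := by
  have h : (((θ.dual R).act s).symm a).1.1 (θ.map s⁻¹ x) = a.1.1 x := by
    conv_rhs => rw [← ((θ.dual R).act s).apply_symm_apply a]
    exact (θ.dualMap_apply_of_mem _ hx).symm
  rw [← h]
  exact θ.dualMap_apply_of_mem _ hx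

theorem dual_twist_apply_of_notMem {s : S} (a : (θ.dual R).ideal s) (b : LocConstAlgebra R X)
    {x : X} (hx : x ∉ θ.dom s) : ((θ.dual R).twist s a b).1 x = 0 :=
  θ.dualMap_apply_of_notMem _ hx

/-- The product of `ℒ(α)` corresponds to convolution: `[s t, y]` factors in exactly one way as a
product of a germ of `s` and a germ of `t`, namely as `[s, θ_t y] [t, y]`. -/
theorem convolution_germFun (s t : S) (a : (θ.dual R).ideal s) (b : (θ.dual R).ideal t) :
    convolution (θ.germFun s a.1.1) (θ.germFun t b.1.1) =
      θ.germFun (s * t) ((θ.dual R).twist s a b.1).1 := by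
  ext c
  by_cases hc : ∃ y, ∃ hy : y ∈ θ.dom t⁻¹, ∃ hx : θ.map t y ∈ θ.dom s⁻¹,
      c = θ.germ (s * t) y (θ.mem_dom_mul hy hx)
  · obtain ⟨y, hy, hx, rfl⟩ := hc
    have hcomp : Germ.src (θ.germ s _ hx) = Germ.rng (θ.germ t y hy) := src_eq_rng_iff.2 rfl
    obtain ⟨h', hm⟩ := mul_germ hx hy hcomp
    rw [convolution, finsum_eq_single _ ⟨⟨(θ.germ s _ hx, θ.germ t y hy), hcomp⟩, hm⟩]
    · rw [germFun_germ, germFun_germ, germFun_germ, (θ.map_comp s t y hy hx).2,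
        dual_twist_apply_of_mem _ _ (θ.map_mem hx), θ.map_inv_map hx]
    · rintro ⟨⟨⟨p, q⟩, hpq⟩, hp⟩ hne
      by_contra hne'
      obtain ⟨y', hy', hx', rfl, rfl⟩ := exists_of_germFun_mul_ne_zero hpq hne'
      obtain ⟨h'', hm'⟩ := mul_germ hx' hy' hpq
      have e2 : y' = y := (θ.germ_eq_iff.1 (hm'.symm.trans hp)).1
      subst e2
      exact hne rfl
  · have hl : convolution (θ.germFun s a.1.1) (θ.germFun t b.1.1) c = 0 := by
      refine finsum_eq_zero_of_forall_eq_zero ?_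
      rintro ⟨⟨⟨p, q⟩, hpq⟩, hp⟩
      by_contra hne'
      obtain ⟨y', hy', hx', rfl, rfl⟩ := exists_of_germFun_mul_ne_zero hpq hne'
      obtain ⟨h'', hm'⟩ := mul_germ hx' hy' hpq
      exact hc ⟨y', hy', hx', hp.symm.trans hm'⟩
    rw [hl]
    symm
    by_contra hne
    obtain ⟨y, hy, rfl⟩ := mem_basic_dom.1 (Set.mem_of_indicator_ne_zero hne)
    rw [germFun_germ] at hne
    have h1 : θ.map (s * t) y ∈ θ.dom s := by
      by_contra h
      exact hne (dual_twist_apply_of_notMem a b.1 h)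
    rw [dual_twist_apply_of_mem a b.1 h1] at hne
    have h2 : θ.map s⁻¹ (θ.map (s * t) y) ∈ θ.dom t := b.2 (right_ne_zero_of_mul hne)
    -- `z` is the point with `θ_s (θ_t z) = θ_{st} y`; it equals `y` since `θ_{st}` is injective.
    set z := θ.map t⁻¹ (θ.map s⁻¹ (θ.map (s * t) y)) with hz
    have hzt : z ∈ θ.dom t⁻¹ := θ.map_inv_mem h2
    have hzs : θ.map t z ∈ θ.dom s⁻¹ := by
      rw [hz, θ.map_map_inv h2]; exact θ.map_inv_mem h1
    have hzy : z = y := by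
      obtain ⟨h3, h4⟩ := θ.map_comp s t z hzt hzs
      rw [hz, θ.map_map_inv h2, θ.map_map_inv h1, ← hz] at h4
      rw [← θ.map_inv_map h3, h4, θ.map_inv_map hy]
    exact hc ⟨z, hzt, hzs, θ.germ_congr rfl hzy.symm⟩

variable [LocallyCompactSpace X] (θ R)

/-- The linear map from `ℒ(α)` to the Steinberg algebra with `a δ_s ↦ germFun s a`. -/
noncomputable def preToSteinberg : (θ.dual R).PreCrossed →ₗ[R] SteinbergAlgebra R θ.Germ :=
  (θ.dual R).liftPre fun s =>
    { toFun := fun f => ⟨θ.germFun s f.1.1, germFun_mem s f⟩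
      map_add' := fun f g => SteinbergAlgebra.ext (germFun_add s f.1.1 g.1.1)
      map_smul' := fun r f => SteinbergAlgebra.ext (germFun_smul s r f.1.1) }

variable {θ R}

theorem toFun_preToSteinberg_delta (s : S) (a : (θ.dual R).ideal s) :
    (θ.preToSteinberg R ((θ.dual R).delta s a)).toFun = θ.germFun s a.1.1 := by
  rw [preToSteinberg, AlgPartialAction.liftPre_delta]
  rfl

theorem preToSteinberg_eq_zero_of_mem {z : (θ.dual R).PreCrossed}
    (hz : z ∈ (θ.dual R).nullIdeal) : θ.preToSteinberg R z = 0 := by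
  rw [AlgPartialAction.mem_nullIdeal] at hz
  induction hz using AddSubgroup.closure_induction with
  | mem z hz =>
    obtain ⟨r, s, h, a, hr, hs, rfl⟩ := hz
    rw [map_sub, sub_eq_zero]
    apply SteinbergAlgebra.ext
    rw [toFun_preToSteinberg_delta, toFun_preToSteinberg_delta]
    exact germFun_mono h hr
  | zero => exact map_zero _
  | add x y _ _ hx hy => rw [map_add, hx, hy, add_zero]
  | neg x _ hx => rw [map_neg, hx, neg_zero]

theorem preToSteinberg_mul (x y : (θ.dual R).PreCrossed) :
    θ.preToSteinberg R (x * y) = θ.preToSteinberg R x * θ.preToSteinberg R y := by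
  induction x using (θ.dual R).pre_induction with
  | h0 => rw [zero_mul, map_zero, zero_mul]
  | hadd x x' hx hx' => rw [add_mul, map_add, map_add, add_mul, hx, hx']
  | hδ s a =>
    induction y using (θ.dual R).pre_induction with
    | h0 => rw [mul_zero, map_zero, mul_zero]
    | hadd y y' hy hy' => rw [mul_add, map_add, map_add, mul_add, hy, hy']
    | hδ t b =>
      apply SteinbergAlgebra.ext
      rw [AlgPartialAction.delta_mul_delta, SteinbergAlgebra.toFun_mul,
        toFun_preToSteinberg_delta, toFun_preToSteinberg_delta, toFun_preToSteinberg_delta,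
        convolution_germFun]

end SteinbergMap

/-! ### Restriction to clopen sets -/

section Localization

variable {R : Type*} [CommRing R] [T2Space X]

theorem support_indicator_subset_dom {s : S} (W : Clopens X) (f : θ.dualIdeal R s) :
    Function.support ((W : Set X).indicator f.1.1) ⊆ θ.dom s := by
  rw [Set.support_indicator]
  exact Set.inter_subset_right.trans f.2

variable (R) in
/-- The characteristic function of a compact clopen set. -/
noncomputable def charFn (W : Clopens X) (hW : IsCompact (W : Set X)) : LocConstAlgebra R X :=
  ⟨(W : Set X).indicator 1, (LocallyConstant.charFn R W.isClopen).isLocallyConstant,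
    hW.of_isClosed_subset
      ((LocallyConstant.charFn R W.isClopen).isLocallyConstant.isClopen_fiber 0).compl.isClosed
      Set.support_indicator_subset⟩

variable (R) in
theorem charFn_mem {W : Clopens X} (hW : IsCompact (W : Set X)) {s : S}
    (hs : (W : Set X) ⊆ θ.dom s) : charFn R W hW ∈ θ.dualIdeal R s :=
  Set.support_indicator_subset.trans hs

variable [ZeroDimSpace X]

/-- The map `a ↦ 1_W a` on `D_s`, for `W` clopen. -/
noncomputable def restrictIdeal (W : Clopens X) (s : S) :
    (θ.dual R).ideal s →ₗ[R] (θ.dual R).ideal s where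
  toFun f := ⟨⟨(W : Set X).indicator f.1.1, indicator_mem W.isClopen f.1⟩,
    support_indicator_subset_dom W f⟩
  map_add' f g := Subtype.ext (Subtype.ext (Set.indicator_add _ f.1.1 g.1.1))
  map_smul' r f := Subtype.ext (Subtype.ext (Set.indicator_const_smul _ r f.1.1))

/-- The map `∑ a_s δ_s ↦ ∑ (1_W a_s) δ_s` on `ℒ(α)`, for `W` clopen. -/
noncomputable def restrictPre (W : Clopens X) :
    (θ.dual R).PreCrossed →ₗ[R] (θ.dual R).PreCrossed :=
  (θ.dual R).liftPre fun s => (θ.dual R).delta s ∘ₗ restrictIdeal W s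

theorem restrictPre_delta (W : Clopens X) (s : S) (a : (θ.dual R).ideal s) :
    restrictPre W ((θ.dual R).delta s a) = (θ.dual R).delta s (restrictIdeal W s a) := by
  rw [restrictPre, AlgPartialAction.liftPre_delta]
  rfl

theorem restrictPre_bot (z : (θ.dual R).PreCrossed) : restrictPre ⊥ z = 0 := by
  induction z using (θ.dual R).pre_induction with
  | h0 => exact map_zero _
  | hadd x y hx hy => rw [map_add, hx, hy, add_zero]
  | hδ s a =>
    rw [restrictPre_delta]
    convert map_zero ((θ.dual R).delta s)
    exact Subtype.ext (Subtype.ext (Set.indicator_empty a.1.1))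

theorem restrictPre_sup {A B : Clopens X} (h : Disjoint A B) (z : (θ.dual R).PreCrossed) :
    restrictPre (A ⊔ B) z = restrictPre A z + restrictPre B z := by
  induction z using (θ.dual R).pre_induction with
  | h0 => simp only [map_zero, add_zero]
  | hadd x y hx hy => rw [map_add, hx, hy, map_add, map_add]; abel
  | hδ s a =>
    rw [restrictPre_delta, restrictPre_delta, restrictPre_delta, ← map_add]
    congr 1
    exact Subtype.ext (Subtype.ext
      (Set.indicator_union_of_disjoint (Clopens.coe_disjoint.2 h) a.1.1))

theorem exists_compact_restrictPre_eq (z : (θ.dual R).PreCrossed) :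
    ∃ K : Set X, IsCompact K ∧ ∀ W : Clopens X, K ⊆ W → restrictPre W z = z := by
  induction z using (θ.dual R).pre_induction with
  | h0 => exact ⟨∅, isCompact_empty, fun W _ => map_zero _⟩
  | hadd x y hx hy =>
    obtain ⟨K, hK, h⟩ := hx
    obtain ⟨L, hL, h'⟩ := hy
    refine ⟨K ∪ L, hK.union hL, fun W hW => ?_⟩
    rw [map_add, h W (Set.subset_union_left.trans hW), h' W (Set.subset_union_right.trans hW)]
  | hδ s a =>
    refine ⟨_, a.1.2.2, fun W hW => ?_⟩
    rw [restrictPre_delta]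
    congr 1
    exact Subtype.ext (Subtype.ext (Set.indicator_eq_self.2 hW))

/-- Membership of the class of `z ∈ ℒ(α)` in a subgroup of the crossed product can be checked
locally on `X`. -/
theorem toCrossed_mem_of_local (H : AddSubgroup (θ.dual R).CrossedProduct)
    (z : (θ.dual R).PreCrossed)
    (h : ∀ x, ∃ W : Clopens X, x ∈ W ∧ ∀ W' ≤ W, (θ.dual R).toCrossed (restrictPre W' z) ∈ H) :
    (θ.dual R).toCrossed z ∈ H := by
  obtain ⟨K, hK, hz⟩ := exists_compact_restrictPre_eq z
  obtain ⟨W, hKW, hW⟩ := hK.exists_clopens_forall_le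
    (fun W => (θ.dual R).toCrossed (restrictPre W z) ∈ H)
    (by rw [restrictPre_bot, map_zero]; exact zero_mem H)
    (fun A B hAB hA hB => by rw [restrictPre_sup hAB, map_add]; exact add_mem hA hB)
    (fun x _ => h x)
  rw [← hz W hKW]
  exact hW W le_rfl

end Localization

/-! ### Local form of an element modulo the null ideal -/

section Stalk

variable {R : Type*} [CommRing R]

variable (θ) in
/-- A semigroup element `s` with `g = [s, x]` for some `x`. -/
noncomputable def germRep (g : θ.Germ) : S := (θ.germ_cases g).choose

theorem exists_germRep (g : θ.Germ) :
    ∃ x, ∃ hx : x ∈ θ.dom (θ.germRep g)⁻¹, g = θ.germ (θ.germRep g) x hx :=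
  (θ.germ_cases g).choose_spec

variable [T2Space X] (θ R)

open scoped Classical in
/-- For `x ∈ X`, the linear map on `ℒ(α)` that sends `a δ_s` to `a(x)` times the germ `[s, y]` with
`θ_s y = x`, and to zero if `x ∉ X_s`. -/
noncomputable def stalk [ZeroDimSpace X] (x : X) :
    (θ.dual R).PreCrossed →ₗ[R] (θ.Germ →₀ R) :=
  (θ.dual R).liftPre fun s =>
    if h : x ∈ θ.dom s then
      Finsupp.lsingle (θ.germ s (θ.map s⁻¹ x) (θ.map_inv_mem h)) ∘ₗ
        (LinearMap.proj x ∘ₗ (LocConstAlgebra R X).toSubmodule.subtype ∘ₗ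
          (θ.dualIdeal R s).subtype)
    else 0

open scoped Classical in
/-- The class of `1_W δ_s` in the crossed product, for `W` a compact clopen subset of `X_s`; it is
set to zero for all other `W`. -/
noncomputable def charClass [ZeroDimSpace X] (s : S) (W : Clopens X) :
    (θ.dual R).CrossedProduct :=
  if h : IsCompact (W : Set X) ∧ (W : Set X) ⊆ θ.dom s then
    (θ.dual R).toCrossed ((θ.dual R).delta s ⟨charFn R W h.1, charFn_mem R h.1 h.2⟩)
  else 0

variable {θ R}

variable [ZeroDimSpace X]

theorem stalk_delta_of_mem {x : X} {s : S} (h : x ∈ θ.dom s) (a : (θ.dual R).ideal s) :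
    θ.stalk R x ((θ.dual R).delta s a) =
      Finsupp.single (θ.germ s (θ.map s⁻¹ x) (θ.map_inv_mem h)) (a.1.1 x) := by
  rw [stalk, AlgPartialAction.liftPre_delta, dif_pos h]
  rfl

theorem stalk_delta_of_notMem {x : X} {s : S} (h : x ∉ θ.dom s) (a : (θ.dual R).ideal s) :
    θ.stalk R x ((θ.dual R).delta s a) = 0 := by
  rw [stalk, AlgPartialAction.liftPre_delta, dif_neg h]
  rfl

open scoped Classical in
/-- The stalk of `z` at `x` is the restriction to the germs with range `x` of the function on
`S ⋉ X` given by `z`. -/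
theorem stalk_apply [LocallyCompactSpace X] (x : X) (z : (θ.dual R).PreCrossed) (g : θ.Germ) :
    θ.stalk R x z g = if g.rngPt = x then (θ.preToSteinberg R z).toFun g else 0 := by
  induction z using (θ.dual R).pre_induction with
  | h0 => simp [SteinbergAlgebra.toFun_zero]
  | hadd y z hy hz =>
    rw [map_add, Finsupp.add_apply, hy, hz, map_add, SteinbergAlgebra.toFun_add]
    split_ifs <;> simp
  | hδ s a =>
    rw [toFun_preToSteinberg_delta]
    by_cases h : x ∈ θ.dom s
    · rw [stalk_delta_of_mem h]
      by_cases hg : g.rngPt = x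
      · subst hg
        rw [if_pos rfl, Finsupp.single_apply, germFun, Set.indicator_apply,
          mem_basic_dom_iff_eq h, Function.comp_apply]
        simp only [eq_comm]
      · rw [if_neg hg, Finsupp.single_apply_eq_zero.2]
        rintro rfl
        exact absurd (θ.map_map_inv h) hg
    · rw [stalk_delta_of_notMem h, Finsupp.zero_apply]
      split_ifs with hg
      · subst hg
        exact (Set.indicator_of_notMem (fun hm => h (rngPt_mem hm)) _).symm
      · rfl

theorem charClass_eq {s : S} {W : Clopens X} (hW : IsCompact (W : Set X))
    (hs : (W : Set X) ⊆ θ.dom s) :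
    θ.charClass R s W =
      (θ.dual R).toCrossed ((θ.dual R).delta s ⟨charFn R W hW, charFn_mem R hW hs⟩) :=
  dif_pos ⟨hW, hs⟩

theorem charClass_eq_of_le {r s : S} (h : NatLE r s) {W : Clopens X} (hW : IsCompact (W : Set X))
    (hr : (W : Set X) ⊆ θ.dom r) : θ.charClass R r W = θ.charClass R s W := by
  have hs : (W : Set X) ⊆ θ.dom s := fun x hx => θ.dom_mono h (hr hx)
  rw [charClass_eq hW hr, charClass_eq hW hs, ← sub_eq_zero, ← map_sub,
    AlgPartialAction.toCrossed_eq_zero, AlgPartialAction.mem_nullIdeal]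
  exact AddSubgroup.subset_closure ⟨r, s, h, _, _, _, rfl⟩

variable (R) in
/-- If `[s, x] = [t, y]`, then `1_W δ_s` and `1_W δ_t` have the same class for all small `W`
around `θ_s x`. -/
theorem exists_charClass_eq [LocallyCompactSpace X] {s t : S} {x y : X}
    {hx : x ∈ θ.dom s⁻¹} {hy : y ∈ θ.dom t⁻¹} (h : θ.germ s x hx = θ.germ t y hy) :
    ∃ W : Clopens X, θ.map s x ∈ W ∧ IsCompact (W : Set X) ∧ (W : Set X) ⊆ θ.dom s ∧
      ∀ W' ≤ W, θ.charClass R s W' = θ.charClass R t W' := by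
  obtain ⟨-, u, hus, hut, hxu⟩ := θ.germ_eq_iff.1 h
  have hm : θ.map s x ∈ θ.dom u := by
    rw [(θ.map_mono _ _ hus x hxu).2]
    exact θ.map_mem hxu
  obtain ⟨W, hxW, hWc, hWu⟩ := exists_compact_clopens (θ.isOpen_dom u) hm
  refine ⟨W, hxW, hWc, fun z hz => θ.dom_mono hus (hWu hz), fun W' hW' => ?_⟩
  have hc := isCompact_clopens_of_le hW' hWc
  have hs : (W' : Set X) ⊆ θ.dom u := fun z hz => hWu (hW' hz)
  rw [← charClass_eq_of_le hus hc hs, ← charClass_eq_of_le hut hc hs]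

/-- Close to `x`, an element of `ℒ(α)` is modulo `𝒩(α)` the combination of the `1_W δ_s` given by
its values on the germs with range `x`. -/
theorem exists_toCrossed_restrictPre_eq [LocallyCompactSpace X] (x : X)
    (z : (θ.dual R).PreCrossed) :
    ∃ W : Clopens X, x ∈ W ∧ ∀ W' ≤ W, (θ.dual R).toCrossed (restrictPre W' z) =
      Finsupp.linearCombination R (fun g => θ.charClass R (θ.germRep g) W') (θ.stalk R x z) := by
  induction z using (θ.dual R).pre_induction with
  | h0 => exact ⟨⊤, trivial, fun W' _ => by simp only [map_zero]⟩
  | hadd y z hy hz =>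
    obtain ⟨W, hxW, hW⟩ := hy
    obtain ⟨V, hxV, hV⟩ := hz
    refine ⟨W ⊓ V, ⟨hxW, hxV⟩, fun W' hW' => ?_⟩
    rw [map_add, map_add, map_add, map_add, hW W' (hW'.trans inf_le_left),
      hV W' (hW'.trans inf_le_right)]
  | hδ s a =>
    by_cases hx : x ∈ θ.dom s
    · obtain ⟨y, hy, hg⟩ := exists_germRep (θ.germ s (θ.map s⁻¹ x) (θ.map_inv_mem hx))
      obtain ⟨W, hxW, hWc, hWs, hW⟩ := exists_charClass_eq R hg
      rw [θ.map_map_inv hx] at hxW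
      obtain ⟨O, hO, hxO, hf⟩ := a.1.2.1.exists_open x
      obtain ⟨V, hxV, -, hVO⟩ := exists_compact_clopens hO hxO
      refine ⟨W ⊓ V, ⟨hxW, hxV⟩, fun W' hW' => ?_⟩
      have hc := isCompact_clopens_of_le (hW'.trans inf_le_left) hWc
      have hs : (W' : Set X) ⊆ θ.dom s := fun z hz => hWs (hW'.trans inf_le_left hz)
      rw [stalk_delta_of_mem hx, Finsupp.linearCombination_single,
        ← hW W' (hW'.trans inf_le_left), charClass_eq hc hs, restrictPre_delta, ← map_smul,
        ← map_smul]
      congr 2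
      refine Subtype.ext (Subtype.ext (funext fun z => ?_))
      change (W' : Set X).indicator a.1.1 z = a.1.1 x * (W' : Set X).indicator 1 z
      by_cases hz : z ∈ (W' : Set X)
      · rw [Set.indicator_of_mem hz, Set.indicator_of_mem hz, Pi.one_apply, mul_one]
        exact hf z (hVO (hW'.trans inf_le_right hz))
      · rw [Set.indicator_of_notMem hz, Set.indicator_of_notMem hz, mul_zero]
    · have hcl : IsClosed (Function.support a.1.1) := a.1.2.2.isClosed
      obtain ⟨W, hxW, -, hW⟩ := exists_compact_clopens hcl.isOpen_compl (fun h => hx (a.2 h))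
      refine ⟨W, hxW, fun W' hW' => ?_⟩
      rw [stalk_delta_of_notMem hx, map_zero, restrictPre_delta]
      convert map_zero (θ.dual R).toCrossed
      convert map_zero ((θ.dual R).delta s)
      refine Subtype.ext (Subtype.ext (Set.indicator_eq_zero'.2 ?_))
      exact (Set.disjoint_left.2 fun z hz hz' => hW (hW' hz') hz)

end Stalk

/-! ### The isomorphism and the diagonals -/

section Isomorphism

variable {R : Type*} [CommRing R] [T2Space X] [ZeroDimSpace X] [LocallyCompactSpace X]

/-- The kernel of the map from `ℒ(α)` to the Steinberg algebra is `𝒩(α)`. -/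
theorem toCrossed_eq_zero_of_preToSteinberg_eq_zero {z : (θ.dual R).PreCrossed}
    (hz : θ.preToSteinberg R z = 0) : (θ.dual R).toCrossed z = 0 := by
  refine AddSubgroup.mem_bot.1 (toCrossed_mem_of_local ⊥ z fun x => ?_)
  obtain ⟨W, hxW, hW⟩ := exists_toCrossed_restrictPre_eq x z
  have h0 : θ.stalk R x z = 0 := by
    ext g
    rw [stalk_apply, hz, SteinbergAlgebra.toFun_zero]
    simp
  exact ⟨W, hxW, fun W' hW' => by rw [hW W' hW', h0, map_zero]; rfl⟩

/-- If the function on `S ⋉ X` given by `z` vanishes off the unit space, then the class of `z` is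
diagonal: around each point `x`, only the unit germ at `x` contributes to the local expression
of `z`. -/
theorem toCrossed_mem_diagonal {z : (θ.dual R).PreCrossed}
    (hz : θ.preToSteinberg R z ∈ steinbergDiagonal R θ.Germ) :
    (θ.dual R).toCrossed z ∈ (θ.dual R).diagonal := by
  refine toCrossed_mem_of_local _ z fun x => ?_
  obtain ⟨W, hxW, hW⟩ := exists_toCrossed_restrictPre_eq x z
  obtain ⟨e, he, hxe⟩ := θ.cover x
  have hxe' : x ∈ θ.dom e⁻¹ := by rwa [inv_of_idem he]
  have hst : θ.stalk R x z =
      Finsupp.single (θ.germ e x hxe') ((θ.preToSteinberg R z).toFun (θ.germ e x hxe')) := by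
    classical
    ext g
    rw [stalk_apply, Finsupp.single_apply]
    by_cases hg : θ.germ e x hxe' = g
    · subst hg
      rw [if_pos ((rngPt_germ e x hxe').trans (θ.map_idem he hxe)), if_pos rfl]
    · rw [if_neg hg]
      split_ifs with hgx
      · by_contra hne
        obtain ⟨b, rfl⟩ := hz hne
        obtain ⟨s, y, hy, rfl⟩ := θ.germ_cases b
        refine hg (θ.germ_idem_eq he (idem_inv_mul s) ?_ _ _)
        exact hgx.symm.trans (θ.map_idem' (idem_inv_mul s) (θ.mem_dom_inv_mul hy))
      · rfl
  obtain ⟨y, hy, hg⟩ := exists_germRep (θ.germ e x hxe')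
  obtain ⟨V, hxV, hVc, hVe, hV⟩ := exists_charClass_eq R hg
  rw [θ.map_idem he hxe] at hxV
  refine ⟨W ⊓ V, ⟨hxW, hxV⟩, fun W' hW' => ?_⟩
  rw [hW W' (hW'.trans inf_le_left), hst, Finsupp.linearCombination_single,
    ← hV W' (hW'.trans inf_le_right),
    charClass_eq (isCompact_clopens_of_le (hW'.trans inf_le_right) hVc)
      (fun z hz => hVe (hW'.trans inf_le_right hz)), ← map_smul, ← map_smul]
  exact AddSubgroup.subset_closure ⟨e, he, _, rfl⟩

variable (R) in
/-- The characteristic function of a compact-open bisection `U` is in the image of `ℒ(α)`: around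
each point of its range, `U` agrees with some `[s, X_{s⁻¹}]`. -/
theorem exists_preToSteinberg_eq_indicator {U : Set θ.Germ}
    (hU : ArrowGroupoid.IsCompactOpenBisection U) :
    ∃ z : (θ.dual R).PreCrossed, (θ.preToSteinberg R z).toFun = U.indicator 1 := by
  obtain ⟨W, hUW, hW⟩ := (hU.2.1.image continuous_rngPt).exists_clopens_forall_le
    (fun W => ∃ z : (θ.dual R).PreCrossed,
      (θ.preToSteinberg R z).toFun = (U ∩ rngPt ⁻¹' W).indicator 1)
    ⟨0, by
      rw [map_zero, SteinbergAlgebra.toFun_zero, Clopens.coe_bot, Set.preimage_empty,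
        Set.inter_empty, Set.indicator_empty]
      rfl⟩
    (by
      rintro A B hAB ⟨z, hz⟩ ⟨z', hz'⟩
      refine ⟨z + z', ?_⟩
      rw [map_add, SteinbergAlgebra.toFun_add, hz, hz', Clopens.coe_sup, Set.preimage_union,
        Set.inter_union_distrib_left, Set.indicator_union_of_disjoint]
      · rfl
      · exact ((Clopens.coe_disjoint.2 hAB).preimage rngPt).mono Set.inter_subset_right
          Set.inter_subset_right)
    (by
      rintro _ ⟨g, hg, rfl⟩
      obtain ⟨s, x, hx, rfl⟩ := θ.germ_cases g
      have hO : IsOpen (θ.map s '' slice s U) := by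
        refine (θ.map s).isOpen_image_of_subset_source (isOpen_iff.1 hU.1 s) ?_
        rw [θ.source_eq]
        exact slice_subset s U
      obtain ⟨W, hxW, hWc, hWO⟩ := exists_compact_clopens hO ⟨x, ⟨hx, hg⟩, rfl⟩
      refine ⟨W, hxW, fun W' hW' => ?_⟩
      have hs : (W' : Set X) ⊆ θ.dom s := fun y hy => by
        obtain ⟨z, hz, rfl⟩ := hWO (hW' hy)
        exact θ.map_mem hz.1
      have hc := isCompact_clopens_of_le hW' hWc
      refine ⟨(θ.dual R).delta s ⟨charFn R W' hc, charFn_mem R hc hs⟩, ?_⟩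
      rw [toFun_preToSteinberg_delta]
      change θ.germFun s ((W' : Set X).indicator 1) = _
      rw [germFun_indicator_one]
      congr 1
      -- `U` and `[s, X_{s⁻¹}]` are bisections containing all `[s, z]` with `θ_s z ∈ W'`, and such a germ
      -- is the only element of either with range `θ_s z`.
      ext a
      constructor
      · rintro ⟨h1, h2⟩
        refine ⟨?_, h2⟩
        obtain ⟨z, hz, hza⟩ := hWO (hW' h2)
        have : a = θ.germ s z hz.1 :=
          (isBisection_basic s _).2 h1 (germ_mem_basic_dom hz.1) (rng_eq_rng_iff.2 hza.symm)
        rw [this]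
        exact hz.2
      · rintro ⟨h1, h2⟩
        refine ⟨?_, h2⟩
        obtain ⟨z, hz, hza⟩ := hWO (hW' h2)
        have : a = θ.germ s z hz.1 := hU.2.2.2 h1 hz.2 (rng_eq_rng_iff.2 hza.symm)
        rw [this]
        exact germ_mem_basic_dom hz.1)
  obtain ⟨z, hz⟩ := hW W le_rfl
  refine ⟨z, hz.trans ?_⟩
  rw [Set.inter_eq_left.2 (Set.image_subset_iff.1 hUW)]

theorem preToSteinberg_surjective : Function.Surjective (θ.preToSteinberg R) := by
  suffices h : ∀ f : θ.Germ → R, f ∈ steinbergSubmodule R θ.Germ →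
      ∃ z : (θ.dual R).PreCrossed, (θ.preToSteinberg R z).toFun = f by
    intro f
    obtain ⟨z, hz⟩ := h f.toFun f.toFun_mem
    exact ⟨z, SteinbergAlgebra.ext hz⟩
  intro f hf
  induction hf using Submodule.span_induction with
  | mem f hf =>
    obtain ⟨U, hU, rfl⟩ := hf
    exact exists_preToSteinberg_eq_indicator R hU
  | zero => exact ⟨0, by rw [map_zero]; rfl⟩
  | add f g _ _ hf hg =>
    obtain ⟨z, rfl⟩ := hf
    obtain ⟨w, rfl⟩ := hg
    exact ⟨z + w, by rw [map_add]; rfl⟩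
  | smul r f _ hf =>
    obtain ⟨z, rfl⟩ := hf
    exact ⟨r • z, by rw [map_smul]; rfl⟩

variable (θ R)

/-- The map from the crossed product to the Steinberg algebra induced by `preToSteinberg`. -/
noncomputable def crossedToSteinberg :
    (θ.dual R).CrossedProduct →ₗ[R] SteinbergAlgebra R θ.Germ :=
  (θ.dual R).liftCrossed (θ.preToSteinberg R) fun _ => preToSteinberg_eq_zero_of_mem

variable {θ R}

theorem crossedToSteinberg_toCrossed (z : (θ.dual R).PreCrossed) :
    θ.crossedToSteinberg R ((θ.dual R).toCrossed z) = θ.preToSteinberg R z := rfl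

theorem crossedToSteinberg_bijective : Function.Bijective (θ.crossedToSteinberg R) := by
  constructor
  · rw [injective_iff_map_eq_zero]
    intro x hx
    obtain ⟨z, rfl⟩ := (θ.dual R).toCrossed_surjective x
    exact toCrossed_eq_zero_of_preToSteinberg_eq_zero hx
  · intro f
    obtain ⟨z, rfl⟩ := preToSteinberg_surjective f
    exact ⟨(θ.dual R).toCrossed z, rfl⟩

theorem crossedToSteinberg_mul (x y : (θ.dual R).CrossedProduct) :
    θ.crossedToSteinberg R (x * y) = θ.crossedToSteinberg R x * θ.crossedToSteinberg R y := by
  obtain ⟨z, rfl⟩ := (θ.dual R).toCrossed_surjective x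
  obtain ⟨w, rfl⟩ := (θ.dual R).toCrossed_surjective y
  exact preToSteinberg_mul z w

theorem crossedToSteinberg_mem_diagonal_iff {x : (θ.dual R).CrossedProduct} :
    θ.crossedToSteinberg R x ∈ steinbergDiagonal R θ.Germ ↔ x ∈ (θ.dual R).diagonal := by
  constructor
  · intro hx
    obtain ⟨z, rfl⟩ := (θ.dual R).toCrossed_surjective x
    exact toCrossed_mem_diagonal hx
  · intro hx
    induction hx using AddSubgroup.closure_induction with
    | mem x hx =>
      obtain ⟨e, he, a, rfl⟩ := hx
      rw [crossedToSteinberg_toCrossed]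
      change Function.support (θ.preToSteinberg R ((θ.dual R).delta e a)).toFun ⊆ _
      rw [toFun_preToSteinberg_delta]
      intro g hg
      obtain ⟨x, hx, -, rfl⟩ := Set.mem_of_indicator_ne_zero hg
      exact ⟨θ.germ e x hx, θ.germ_idem_eq (idem_inv_mul e) he rfl _ _⟩
    | zero => rw [map_zero]; exact zero_mem _
    | add x y _ _ hx hy => rw [map_add]; exact add_mem hx hy
    | neg x _ hx => rw [map_neg]; exact neg_mem hx

end Isomorphism

end TopPartialAction

theorem mainTheorem1 {R S X : Type*} [CommRing R] [InverseSemigroup S] [TopologicalSpace X]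
    [LocallyCompactSpace X] [T2Space X] [ZeroDimSpace X] (θ : TopPartialAction S X) :
    ∃ Φ : SteinbergAlgebra R θ.Germ →ₙₐ[R] (θ.dual R).CrossedProduct,
      Function.Bijective Φ ∧
        Φ '' (steinbergDiagonal R θ.Germ : Set (SteinbergAlgebra R θ.Germ)) =
          ((θ.dual R).diagonal : Set (θ.dual R).CrossedProduct) := by
  let E := LinearEquiv.ofBijective (θ.crossedToSteinberg R)
    TopPartialAction.crossedToSteinberg_bijective
  have hE : ∀ x y, E (x * y) = E x * E y := TopPartialAction.crossedToSteinberg_mul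
  refine ⟨{ toFun := E.symm
            map_smul' := E.symm.map_smul
            map_zero' := E.symm.map_zero
            map_add' := E.symm.map_add
            map_mul' := fun f g => by
              rw [LinearEquiv.symm_apply_eq, hE, E.apply_symm_apply, E.apply_symm_apply] },
    E.symm.bijective, ?_⟩
  change E.symm '' _ = _
  rw [LinearEquiv.image_symm_eq_preimage]
  ext x
  exact TopPartialAction.crossedToSteinberg_mem_diagonal_iff
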